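/- Let $\mathbb{R}_+=[0,\infty)$ and $\mathbb{R}_{++}=(0,\infty)$. Throughout, ``increasing'' and ``decreasing'' are meant strictly. Let $W_1$ be the set of locally integrable functions $c:\mathbb{R}_+\to\mathbb{R}_+$ and $W_2$ the set of measurable, locally bounded functions $c:\mathbb{R}_+\to\mathbb{R}_+$. Let $\rho\in\mathbb{R}$, $u:\mathbb{R}_+^2\to\mathbb{R}\cup\{-\infty\}$, $(c,k)\mapsto u(c,k)$, and $F:\mathbb{R}_+^2\to\mathbb{R}$, $(k,c)\mapsto F(k,c)$, satisfy the following assumptions. (A1) $\rho>0$, and $W=W_1$ or $W=W_2$. (A2) $u$ is continuous and concave on $\mathbb{R}_+^2$ and nondecreasing (in both variables); on $\mathbb{R}_{++}^2$ it is increasing in $c$ and continuously differentiable; and there is $c>0$ with $u(c,0)>-\infty$. (A3) $F$ is continuous and concave, $F(0,0)=0$, and $F$ is decreasing in $c$. There are $d_1>0$ and an increasing $\delta_2:\mathbb{R}_+\to\mathbb{R}_+$ with $\delta_2(0)=0$ such that $F(k,c)>-d_1k-\delta_2(c)$ for all $k>0$, $c\ge 0$, where, if $W=W_1$, $\delta_2(c)=d_2c$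 for all $c\ge0$ with some $d_2\ge 0$. For every $c\ge 0$ there is $k>0$ with $F(k,c)>F(0,c)$. (A4) For every $k>0$: $\frac{\partial u}{\partial c}(c,k)$ is decreasing in $c>0$, $\lim_{c\downarrow0}\frac{\partial u}{\partial c}(c,k)=+\infty$, $\lim_{c\to\infty}\frac{\partial u}{\partial c}(c,k)=0$, and $\limsup_{c\downarrow 0}\frac{\partial u}{\partial k}(c,k)<+\infty$. (A5) There are $k_0>0$, $c_0\ge0$, $\gamma,\delta,\theta,a>0$, $b\ge0$, $C\in\mathbb{R}$ such that $F(k,c)-F(k_0,c_0)\le\gamma(k-k_0)-\delta(c-c_0)$ for all $k,c\ge0$, $\rho-(1-\theta)\gamma>0$, and $u(c,k)\le a u_\theta(c)+b u_\theta(k)+C$ for all $c,k>0$, where $u_\theta(x)=\frac{x^{1-\theta}-1}{1-\theta}$ if $\theta\ne1$ and $u_1(x)=\log x$. For $\bar k\ge 0$ let $A_{\bar k}$ be the set of pairs $(k,c)$ of functions $\mathbb{R}_+\to\mathbb{R}_+$ such that $k$ is absolutely continuous on every compact interval, $c\in W$, the Lebesgue integral $\int_0^\infty e^{-\rho t}u(c(t),k(t))\,dt$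 can be defined (possibly as $\pm\infty$), $\dot k(t)=F(k(t),c(t))$ for almost every $t\ge 0$, and $k(0)=\bar k$. For $\bar k>0$ let $\bar V(\bar k)$ be the supremum of these integrals over $A_{\bar k}$, and let $\partial\bar V(k)$ be the set of $p\in\mathbb{R}$ such that $\bar V(k)\in\mathbb{R}$ and $\bar V(y)\le\bar V(k)+p(y-k)$ for all $y>0$. A pair $(k^*,c^*)\in A_{\bar k}$ is called optimal if its integral is a real number and is at least the integral of every other pair in $A_{\bar k}$. For $p,k>0$ let $c^*(p,k)>0$ denote the unique maximizer over $c\ge0$ of $F(k,c)p+u(c,k)$, and write $c^*(P,k)=\{c^*(p,k)\mid p\in P\}$ and $F(k,E)=\{F(k,c)\mid c\in E\}$ (only those $p>0$ in $P$ for which such a positive unique maximizer exists contribute). Then for every optimal pair $(k^*,c^*)\in A_{\bar k}$ with $\inf_{t\ge0}k^*(t)>0$, the function $k^*$ is a solution on $\mathbb{R}_+$ of the differential inclusion $$\dot k(t)\in F\bigl(k(t),c^*(\partial\bar V(k(t)),k(t))\bigr),\qquad k(0)=\bar k,$$ that is, $k^*$ takes values in $\mathbb{R}_{++}$, is absolutely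 continuous on every compact interval, satisfies $k^*(0)=\bar k$, and satisfies the inclusion for almost every $t\ge0$. Moreover, $c^*(t)\in c^*(\partial\bar V(k^*(t)),k^*(t))$ for almost every $t\ge0$. -/

import Mathlib

open Set Filter Topology MeasureTheory
open scoped ENNReal

namespace RCK

/-!  Functions of time and the data `u`, `F` are total functions in Lean, but only their values on
the nonnegative half line, respectively the nonnegative quadrant, are ever used. The arguments are
ordered as `u c k` and `F k c`, with `c` the consumption and `k` the capital stock. -/

/-- The nonnegative quadrant. -/
def Quadrant : Set (ℝ × ℝ) := Ici 0 ×ˢ Ici 0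

/-- The open positive quadrant. -/
def PosQuadrant : Set (ℝ × ℝ) := Ioi 0 ×ˢ Ioi 0

/-- Nonnegative, locally integrable functions of time. -/
def W₁ : Set (ℝ → ℝ) :=
  {c | (∀ t, 0 ≤ t → 0 ≤ c t) ∧ ∀ T, 0 ≤ T → IntegrableOn c (Icc 0 T) volume}

/-- Nonnegative, (Lebesgue) measurable and locally bounded functions of time. -/
def W₂ : Set (ℝ → ℝ) :=
  {c | (∀ t, 0 ≤ t → 0 ≤ c t) ∧ AEMeasurable c (volume.restrict (Ici 0)) ∧
    ∀ T, 0 ≤ T → ∃ M : ℝ, ∀ t ∈ Icc 0 T, c t ≤ M}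

/-- The partial derivative of the utility function in consumption (on the open positive quadrant,
where `u` is real-valued). -/
noncomputable def utilityDerivC (u : ℝ → ℝ → EReal) (c k : ℝ) : ℝ :=
  deriv (fun c' => (u c' k).toReal) c

/-- The partial derivative of the utility function in capital (on the open positive quadrant,
where `u` is real-valued). -/
noncomputable def utilityDerivK (u : ℝ → ℝ → EReal) (c k : ℝ) : ℝ :=
  deriv (fun k' => (u c k').toReal) k

/-- The standing assumption on the utility function `u`, which takes values in `ℝ ∪ {-∞}`. -/
structure UtilityAssumption (u : ℝ → ℝ → EReal) : Prop where
  ne_top : ∀ c k, 0 ≤ c → 0 ≤ k → u c k ≠ ⊤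
  continuousOn : ContinuousOn (fun x : ℝ × ℝ => u x.1 x.2) Quadrant
  concave : ∀ x ∈ Quadrant, ∀ y ∈ Quadrant, ∀ a b : ℝ, 0 < a → 0 < b → a + b = 1 →
    (a : EReal) * u x.1 x.2 + (b : EReal) * u y.1 y.2
      ≤ u (a * x.1 + b * y.1) (a * x.2 + b * y.2)
  monotone : ∀ c c' k k', 0 ≤ c → c ≤ c' → 0 ≤ k → k ≤ k' → u c k ≤ u c' k'
  increasing_c : ∀ c c' k, 0 < c → c < c' → 0 < k → u c k < u c' k
  contDiffOn : ContDiffOn ℝ 1 (fun x : ℝ × ℝ => (u x.1 x.2).toReal) PosQuadrant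
  finite_at_zero : ∃ c : ℝ, 0 < c ∧ u c 0 ≠ ⊥

/-- The standing assumption on the technology function `F`, given the class `W` of consumption
paths. -/
structure TechnologyAssumption (W : Set (ℝ → ℝ)) (F : ℝ → ℝ → ℝ) : Prop where
  continuousOn : ContinuousOn (fun x : ℝ × ℝ => F x.1 x.2) Quadrant
  concaveOn : ConcaveOn ℝ Quadrant (fun x : ℝ × ℝ => F x.1 x.2)
  zero : F 0 0 = 0
  decreasing_c : ∀ k c c', 0 ≤ k → 0 ≤ c → c < c' → F k c' < F k c
  lower_bound : ∃ d₁ : ℝ, 0 < d₁ ∧ ∃ δ₂ : ℝ → ℝ, StrictMonoOn δ₂ (Ici 0) ∧ δ₂ 0 = 0 ∧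
    (∀ k c, 0 < k → 0 ≤ c → -d₁ * k - δ₂ c < F k c) ∧
    (W = W₁ → ∃ d₂ : ℝ, 0 ≤ d₂ ∧ ∀ c, 0 ≤ c → δ₂ c = d₂ * c)
  productive : ∀ c, 0 ≤ c → ∃ k, 0 < k ∧ F 0 c < F k c

/-- The Inada-type assumption on the derivatives of the utility function. -/
structure InadaAssumption (u : ℝ → ℝ → EReal) : Prop where
  derivC_decreasing : ∀ k, 0 < k → StrictAntiOn (fun c => utilityDerivC u c k) (Ioi 0)
  derivC_zero : ∀ k, 0 < k → Tendsto (fun c => utilityDerivC u c k) (𝓝[>] 0) atTop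
  derivC_infty : ∀ k, 0 < k → Tendsto (fun c => utilityDerivC u c k) atTop (𝓝 0)
  derivK_limsup : ∀ k, 0 < k →
    limsup (fun c => ((utilityDerivK u c k : ℝ) : EReal)) (𝓝[>] 0) < ⊤

/-- The function of constant relative risk aversion `θ` (used at positive arguments). -/
noncomputable def crra (θ x : ℝ) : ℝ :=
  if θ = 1 then Real.log x else (x ^ (1 - θ) - 1) / (1 - θ)

/-- `(p, q)` is a supergradient of `F` at `(k₀, c₀)`, relative to the nonnegative quadrant. -/
def IsSupergradient₂ (F : ℝ → ℝ → ℝ) (k₀ c₀ p q : ℝ) : Prop :=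
  ∀ k c, 0 ≤ k → 0 ≤ c → F k c - F k₀ c₀ ≤ p * (k - k₀) + q * (c - c₀)

/-- The growth assumption linking the discount rate, the technology and the utility. -/
def GrowthAssumption (ρ : ℝ) (u : ℝ → ℝ → EReal) (F : ℝ → ℝ → ℝ) : Prop :=
  ∃ k₀ c₀ γ δ θ a b C : ℝ, 0 < k₀ ∧ 0 ≤ c₀ ∧ 0 < γ ∧ 0 < δ ∧ 0 < θ ∧ 0 < a ∧ 0 ≤ b ∧
    IsSupergradient₂ F k₀ c₀ γ (-δ) ∧
    0 < ρ - (1 - θ) * γ ∧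
    ∀ c k, 0 < c → 0 < k → u c k ≤ ((a * crra θ c + b * crra θ k + C : ℝ) : EReal)

/-- The integral of the positive part of discounted utility along `(k, c)`. -/
noncomputable def utilityPos (ρ : ℝ) (u : ℝ → ℝ → EReal) (k c : ℝ → ℝ) : ℝ≥0∞ :=
  ∫⁻ t in Ici (0 : ℝ), ENNReal.ofReal (Real.exp (-ρ * t)) * (u (c t) (k t)).toENNReal

/-- The integral of the negative part of discounted utility along `(k, c)`. -/
noncomputable def utilityNeg (ρ : ℝ) (u : ℝ → ℝ → EReal) (k c : ℝ → ℝ) : ℝ≥0∞ :=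
  ∫⁻ t in Ici (0 : ℝ), ENNReal.ofReal (Real.exp (-ρ * t)) * (-(u (c t) (k t))).toENNReal

/-- The total discounted utility can be defined, possibly as `±∞`. -/
def UtilityDefined (ρ : ℝ) (u : ℝ → ℝ → EReal) (k c : ℝ → ℝ) : Prop :=
  utilityPos ρ u k c ≠ ⊤ ∨ utilityNeg ρ u k c ≠ ⊤

/-- The total discounted utility `∫₀^∞ e^{-ρt} u(c(t),k(t)) dt` in `[-∞, ∞]`, meaningful when
`UtilityDefined` holds. -/
noncomputable def totalUtility (ρ : ℝ) (u : ℝ → ℝ → EReal) (k c : ℝ → ℝ) : EReal :=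
  (utilityPos ρ u k c : EReal) - (utilityNeg ρ u k c : EReal)

/-- Absolute continuity on every compact subinterval of `[0, ∞)`. -/
def LocallyAC (k : ℝ → ℝ) : Prop :=
  ∀ T, 0 ≤ T → AbsolutelyContinuousOnInterval k 0 T

/-- The pair `(k, c)` is admissible with initial capital stock `kbar`. -/
structure Admissible (ρ : ℝ) (W : Set (ℝ → ℝ)) (u : ℝ → ℝ → EReal) (F : ℝ → ℝ → ℝ) (kbar : ℝ)
    (k c : ℝ → ℝ) : Prop where
  locallyAC : LocallyAC k
  mem_class : c ∈ W
  nonneg_k : ∀ t, 0 ≤ t → 0 ≤ k t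
  nonneg_c : ∀ t, 0 ≤ t → 0 ≤ c t
  utilityDefined : UtilityDefined ρ u k c
  hasDerivAt : ∀ᵐ t ∂(volume.restrict (Ici (0 : ℝ))), HasDerivAt k (F (k t) (c t)) t
  initial : k 0 = kbar

/-- The value function, with values in `[-∞, ∞]`. -/
noncomputable def valueFunction (ρ : ℝ) (W : Set (ℝ → ℝ)) (u : ℝ → ℝ → EReal) (F : ℝ → ℝ → ℝ)
    (kbar : ℝ) : EReal :=
  sSup {J | ∃ k c : ℝ → ℝ, Admissible ρ W u F kbar k c ∧ J = totalUtility ρ u k c}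

/-- `(k, c)` is a solution of the maximization problem with initial capital stock `kbar`. -/
structure IsOptimal (ρ : ℝ) (W : Set (ℝ → ℝ)) (u : ℝ → ℝ → EReal) (F : ℝ → ℝ → ℝ) (kbar : ℝ)
    (k c : ℝ → ℝ) : Prop where
  admissible : Admissible ρ W u F kbar k c
  ne_top : totalUtility ρ u k c ≠ ⊤
  ne_bot : totalUtility ρ u k c ≠ ⊥
  maximal : ∀ k' c' : ℝ → ℝ, Admissible ρ W u F kbar k' c' →
    totalUtility ρ u k' c' ≤ totalUtility ρ u k c

/-- The superdifferential at `x` of a function on the positive half line; empty unless the value at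
`x` is a real number. -/
def superdifferential (V : ℝ → EReal) (x : ℝ) : Set ℝ :=
  {p | V x ≠ ⊤ ∧ V x ≠ ⊥ ∧ ∀ y, 0 < y → V y ≤ V x + ((p * (y - x) : ℝ) : EReal)}

/-- The graph of the function `c*(p, k)`: for `p, k > 0`, the number `c` is positive and the unique
maximizer over `[0, ∞)` of `c' ↦ F(k, c') p + u(c', k)`. -/
def IsPolicyValue (u : ℝ → ℝ → EReal) (F : ℝ → ℝ → ℝ) (p k c : ℝ) : Prop :=
  0 < p ∧ 0 < k ∧ 0 < c ∧ ∀ c', 0 ≤ c' → c' ≠ c →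
    ((F k c' * p : ℝ) : EReal) + u c' k < ((F k c * p : ℝ) : EReal) + u c k

/-- The image `c*(P, k) = {c*(p, k) | p ∈ P}`. -/
def policySet (u : ℝ → ℝ → EReal) (F : ℝ → ℝ → ℝ) (P : Set ℝ) (k : ℝ) : Set ℝ :=
  {c | ∃ p ∈ P, IsPolicyValue u F p k c}

/-- The set-valued right-hand side `k ↦ F(k, c*(∂V(k), k))` of the differential inclusion. -/
def inclusionMap (u : ℝ → ℝ → EReal) (F : ℝ → ℝ → ℝ) (V : ℝ → EReal) (k : ℝ) : Set ℝ :=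
  F k '' policySet u F (superdifferential V k) k

/-- `k` is a solution on `[0, ∞)`, with positive values, of the differential inclusion
`k'(t) ∈ Γ(k(t))`, `k(0) = kbar`. -/
structure IsInclusionSolution (Γ : ℝ → Set ℝ) (kbar : ℝ) (k : ℝ → ℝ) : Prop where
  pos : ∀ t, 0 ≤ t → 0 < k t
  locallyAC : LocallyAC k
  initial : k 0 = kbar
  hasDerivAt_mem : ∀ᵐ t ∂(volume.restrict (Ici (0 : ℝ))), ∃ v ∈ Γ (k t), HasDerivAt k v t

end RCK

/-! The argument is dynamic programming by hand: neither differentiability of the value function `V`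
nor a maximum principle is used. Trajectories are relaxed to `FeasibleOn`: capital grows at a rate
`v ≤ F(k, c)` and is credited a utility `w ≤ u(c, k)`. Since `F` and `u` are concave, relaxed
trajectories form a convex family. Slack in the growth rate can be consumed and `u` is monotone, so
the relaxation does not change the supremum (`isLUB_valueFunction`). The growth assumption bounds
the values, hence `V` is real and concave on the positive half line (`realValue_combo_le`).

Moving capital for a short time at speed `F(x, c)` gives `V(x + s F(x, c)) - V(x) ≤ s (ρ V(x) - u(c,
x))` whenever the left side makes sense (`realValue_sub_le`). By a one-dimensional Helly argument,
this inequality and concavity yield a single `p ∈ ∂V(x)` with `p F(x, c) + u(c, x) ≤ ρ V(x)` for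
every `c > 0` (`exists_price`).

Along an optimal pair, `V(k(t))` is the current value of the remaining utility
(`realValue_eq_of_optimal`), so it has derivative `ρ V(k(t)) - u(c(t), k(t))` at almost every `t`.
The line with slope `p` touches `V` from above at `k(t)`, so this derivative equals `p F(k(t),
c(t))`: the Hamiltonian inequality is an equality at `c(t)`. Thus `c(t)` maximizes the Hamiltonian,
and strict concavity with the Inada condition makes it the positive unique maximizer
(`isPolicyValue_of_le`). The inclusion follows by substituting into `k' = F(k, c)`. -/

namespace RCK

/-! ### Closure properties of the two classes of consumption paths -/

section Classes

variable {W : Set (ℝ → ℝ)} {c g : ℝ → ℝ}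

lemma aemeasurable_of_integrableOn_Icc (hv : ∀ T, 0 ≤ T → IntegrableOn c (Icc 0 T)) :
    AEMeasurable c (volume.restrict (Ici 0)) := by
  have h : (Ici (0 : ℝ)) = ⋃ n : ℕ, Icc 0 (n : ℝ) := by
    ext t
    simp only [mem_Ici, mem_iUnion, mem_Icc]
    exact ⟨fun ht => (exists_nat_ge t).imp fun n hn => ⟨ht, hn⟩, fun ⟨n, hn⟩ => hn.1⟩
  rw [h, aemeasurable_iUnion_iff]
  exact fun n => (hv n n.cast_nonneg).aestronglyMeasurable.aemeasurable

lemma W₁_aemeasurable (hc : c ∈ W₁) : AEMeasurable c (volume.restrict (Ici 0)) :=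
  aemeasurable_of_integrableOn_Icc hc.2

lemma mem_W₁_of_le (hg : g ∈ W₁) (hc : AEMeasurable c (volume.restrict (Ici 0)))
    (h0 : ∀ t, 0 ≤ t → 0 ≤ c t) (hcg : ∀ t, 0 ≤ t → c t ≤ g t) : c ∈ W₁ := by
  refine ⟨h0, fun T hT => ?_⟩
  refine Integrable.mono' (hg.2 T hT)
    (hc.mono_measure (Measure.restrict_mono Icc_subset_Ici_self le_rfl)).aestronglyMeasurable ?_
  filter_upwards [ae_restrict_mem measurableSet_Icc] with t ht
  rw [Real.norm_of_nonneg (h0 t ht.1)]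
  exact hcg t ht.1

/-- Writes both classes as `W₁` plus a local bound that is waived when `W = W₁`, so that each
closure property is proved once. -/
lemma mem_class_iff (hW : W = W₁ ∨ W = W₂) :
    c ∈ W ↔ c ∈ W₁ ∧ (W = W₁ ∨ ∀ T, 0 ≤ T → ∃ M : ℝ, ∀ t ∈ Icc 0 T, c t ≤ M) := by
  by_cases h1 : W = W₁
  · simp [h1]
  · have h2 := hW.resolve_left h1
    subst h2
    simp only [h1, false_or]
    constructor
    · rintro ⟨h0, hm, hb⟩
      refine ⟨⟨h0, fun T hT => ?_⟩, hb⟩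
      obtain ⟨M, hM⟩ := hb T hT
      refine Integrable.mono' (g := fun _ => M) (by simp)
        (hm.mono_measure (Measure.restrict_mono Icc_subset_Ici_self le_rfl)).aestronglyMeasurable ?_
      filter_upwards [ae_restrict_mem measurableSet_Icc] with t ht
      rw [Real.norm_of_nonneg (h0 t ht.1)]
      exact hM t ht
    · rintro ⟨h, hb⟩
      exact ⟨h.1, W₁_aemeasurable h, hb⟩

lemma class_subset (hW : W = W₁ ∨ W = W₂) (hc : c ∈ W) : c ∈ W₁ := ((mem_class_iff hW).1 hc).1

lemma class_of_le (hW : W = W₁ ∨ W = W₂) (hg : g ∈ W)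
    (hc : AEMeasurable c (volume.restrict (Ici 0)))
    (h0 : ∀ t, 0 ≤ t → 0 ≤ c t) (hcg : ∀ t, 0 ≤ t → c t ≤ g t) : c ∈ W := by
  rw [mem_class_iff hW] at hg ⊢
  refine ⟨mem_W₁_of_le hg.1 hc h0 hcg, hg.2.imp_right fun h T hT => ?_⟩
  obtain ⟨M, hM⟩ := h T hT
  exact ⟨M, fun t ht => (hcg t ht.1).trans (hM t ht)⟩

lemma class_add (hW : W = W₁ ∨ W = W₂) (hc : c ∈ W) (hg : g ∈ W) :
    (fun t => c t + g t) ∈ W := by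
  rw [mem_class_iff hW] at hc hg ⊢
  refine ⟨⟨fun t ht => add_nonneg (hc.1.1 t ht) (hg.1.1 t ht),
    fun T hT => (hc.1.2 T hT).add (hg.1.2 T hT)⟩, ?_⟩
  rcases hc.2 with h | hcb
  · exact Or.inl h
  rcases hg.2 with h | hgb
  · exact Or.inl h
  refine Or.inr fun T hT => ?_
  obtain ⟨M, hM⟩ := hcb T hT
  obtain ⟨N, hN⟩ := hgb T hT
  exact ⟨M + N, fun t ht => add_le_add (hM t ht) (hN t ht)⟩

lemma class_const_mul (hW : W = W₁ ∨ W = W₂) {a : ℝ} (ha : 0 ≤ a) (hc : c ∈ W) :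
    (fun t => a * c t) ∈ W := by
  rw [mem_class_iff hW] at hc ⊢
  refine ⟨⟨fun t ht => mul_nonneg ha (hc.1.1 t ht), fun T hT => (hc.1.2 T hT).const_mul a⟩,
    hc.2.imp_right fun h T hT => ?_⟩
  obtain ⟨M, hM⟩ := h T hT
  exact ⟨a * M, fun t ht => mul_le_mul_of_nonneg_left (hM t ht) ha⟩

lemma class_of_continuousOn (hW : W = W₁ ∨ W = W₂) (hc : ContinuousOn c (Ici 0))
    (h0 : ∀ t, 0 ≤ t → 0 ≤ c t) : c ∈ W := by
  rw [mem_class_iff hW]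
  refine ⟨⟨h0, fun T hT => (hc.mono Icc_subset_Ici_self).integrableOn_Icc⟩, Or.inr fun T hT => ?_⟩
  obtain ⟨M, hM⟩ := isCompact_Icc.bddAbove_image (hc.mono (Icc_subset_Ici_self : Icc 0 T ⊆ Ici 0))
  exact ⟨M, fun t ht => hM (mem_image_of_mem c ht)⟩

lemma class_shift (hW : W = W₁ ∨ W = W₂) {h : ℝ} (hh : 0 ≤ h) (hc : c ∈ W) :
    (fun t => c (h + t)) ∈ W := by
  rw [mem_class_iff hW] at hc ⊢
  refine ⟨⟨fun t ht => hc.1.1 _ (by linarith), fun T hT => ?_⟩, hc.2.imp_right fun hb T hT => ?_⟩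
  · have h1 : IntegrableOn c (Icc h (h + T)) :=
      (hc.1.2 (h + T) (by linarith)).mono_set (Icc_subset_Icc_left hh)
    have h2 := (measurePreserving_add_left volume h).integrableOn_comp_preimage
      (measurableEmbedding_addLeft h) (f := c) (s := Icc h (h + T))
    have h3 := h2.2 h1
    simpa [Function.comp_def] using h3
  · obtain ⟨M, hM⟩ := hb (h + T) (by linarith)
    exact ⟨M, fun t ht => hM _ ⟨by linarith [ht.1], by linarith [ht.2]⟩⟩

/-- Follow `f` until time `h`, then `g` started afresh. -/
noncomputable def concat (h : ℝ) (f g : ℝ → ℝ) (t : ℝ) : ℝ := if t < h then f t else g (t - h)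

lemma concat_of_lt {h t : ℝ} {f g : ℝ → ℝ} (ht : t < h) : concat h f g t = f t := if_pos ht

lemma concat_of_ge {h t : ℝ} {f g : ℝ → ℝ} (ht : h ≤ t) : concat h f g t = g (t - h) :=
  if_neg (not_lt.2 ht)

lemma concat_integrableOn {h : ℝ} (hh : 0 ≤ h) {f g : ℝ → ℝ} (hf : IntegrableOn f (Icc 0 h)) {T : ℝ}
    (hg : IntegrableOn g (Icc 0 T)) : IntegrableOn (concat h f g) (Icc 0 T) := by
  have h1 : IntegrableOn (concat h f g) (Ico 0 h) :=
    (hf.mono_set Ico_subset_Icc_self).congr_fun (fun t ht => (concat_of_lt ht.2).symm)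
      measurableSet_Ico
  have h2 : IntegrableOn (fun t => g (t - h)) (Icc h (T + h)) := by
    have := ((measurePreserving_sub_right volume h).integrableOn_comp_preimage
      (measurableEmbedding_subRight h) (f := g) (s := Icc 0 T)).2 hg
    simpa [Function.comp_def] using this
  have h3 : IntegrableOn (concat h f g) (Icc h (T + h)) :=
    h2.congr_fun (fun t ht => (concat_of_ge ht.1).symm) measurableSet_Icc
  refine (h1.union h3).mono_set fun t ht => ?_
  rcases lt_or_ge t h with h' | h'
  · exact Or.inl ⟨ht.1, h'⟩
  · exact Or.inr ⟨h', by linarith [ht.2, ht.1]⟩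

lemma class_concat (hW : W = W₁ ∨ W = W₂) {h : ℝ} (hh : 0 ≤ h) (hc : c ∈ W) (hg : g ∈ W) :
    concat h c g ∈ W := by
  rw [mem_class_iff hW] at hc hg ⊢
  refine ⟨⟨fun t ht => ?_, fun T hT => concat_integrableOn hh (hc.1.2 h hh) (hg.1.2 T hT)⟩, ?_⟩
  · rcases lt_or_ge t h with h' | h'
    · rw [concat_of_lt h']; exact hc.1.1 t ht
    · rw [concat_of_ge h']; exact hg.1.1 _ (by linarith)
  rcases hc.2 with h | hcb
  · exact Or.inl h
  rcases hg.2 with h | hgb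
  · exact Or.inl h
  refine Or.inr fun T hT => ?_
  obtain ⟨M, hM⟩ := hcb T hT
  obtain ⟨N, hN⟩ := hgb T hT
  refine ⟨max M N, fun t ht => ?_⟩
  rcases lt_or_ge t h with h' | h'
  · rw [concat_of_lt h']; exact (hM t ht).trans (le_max_left _ _)
  · rw [concat_of_ge h']
    exact (hN _ ⟨by linarith, by linarith [ht.2]⟩).trans (le_max_right _ _)

lemma ae_restrict_Ici_shift {h : ℝ} {P : ℝ → Prop}
    (hP : ∀ᵐ t ∂(volume.restrict (Ici (0 : ℝ))), P t) :
    ∀ᵐ t ∂(volume.restrict (Ici h)), P (t - h) := by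
  rw [ae_restrict_iff' measurableSet_Ici] at hP ⊢
  have := (measurePreserving_sub_right volume h).quasiMeasurePreserving.ae hP
  filter_upwards [this] with t ht hth
  exact ht (by simpa using hth)

lemma ae_restrict_Ici_shift_add {h : ℝ} (hh : 0 ≤ h) {P : ℝ → Prop}
    (hP : ∀ᵐ t ∂(volume.restrict (Ici (0 : ℝ))), P t) :
    ∀ᵐ t ∂(volume.restrict (Ici (0 : ℝ))), P (h + t) := by
  rw [ae_restrict_iff' measurableSet_Ici] at hP ⊢
  have := (measurePreserving_add_left volume h).quasiMeasurePreserving.ae hP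
  filter_upwards [this] with t ht ht0
  exact ht (add_nonneg hh ht0)

lemma ae_restrict_Ici_split {h : ℝ} {P : ℝ → Prop}
    (h1 : ∀ᵐ t ∂(volume.restrict (Icc 0 h)), P t)
    (h2 : ∀ᵐ t ∂(volume.restrict (Ici h)), P t) :
    ∀ᵐ t ∂(volume.restrict (Ici (0 : ℝ))), P t := by
  rw [ae_restrict_iff' measurableSet_Icc] at h1
  rw [ae_restrict_iff' measurableSet_Ici] at h2 ⊢
  filter_upwards [h1, h2] with t ht1 ht2 ht
  rcases le_or_gt h t with h' | h'
  · exact ht2 h'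
  · exact ht1 ⟨ht, h'.le⟩

end Classes

/-! ### Bounds on the technology and its inversion in consumption -/

section Technology

variable {W : Set (ℝ → ℝ)} {F : ℝ → ℝ → ℝ} {ρ : ℝ} {u : ℝ → ℝ → EReal}

lemma TechnologyAssumption.continuous_ext (hF : TechnologyAssumption W F) :
    Continuous fun p : ℝ × ℝ => F (max p.1 0) (max p.2 0) :=
  hF.continuousOn.comp_continuous (f := fun p : ℝ × ℝ => (max p.1 0, max p.2 0)) (by fun_prop)
    fun _ => ⟨mem_Ici.2 (le_max_right _ _), mem_Ici.2 (le_max_right _ _)⟩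

lemma UtilityAssumption.continuous_ext (hu : UtilityAssumption u) :
    Continuous fun p : ℝ × ℝ => u (max p.1 0) (max p.2 0) :=
  hu.continuousOn.comp_continuous (f := fun p : ℝ × ℝ => (max p.1 0, max p.2 0)) (by fun_prop)
    fun _ => ⟨mem_Ici.2 (le_max_right _ _), mem_Ici.2 (le_max_right _ _)⟩

/-- A minorant `-(d k + δ c)` of the technology whose absolute value preserves the class of
consumption paths. -/
lemma TechnologyAssumption.exists_lower_bound (hW : W = W₁ ∨ W = W₂)
    (hF : TechnologyAssumption W F) :
    ∃ d : ℝ, 0 < d ∧ ∃ φ : ℝ → ℝ, (∀ k c, 0 ≤ k → 0 ≤ c → -(d * k + φ c) ≤ F k c) ∧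
      ∀ c ∈ W, (fun t => φ (c t)) ∈ W := by
  obtain ⟨d, hd, φ, hmono, hφ0, hb, hlin⟩ := hF.lower_bound
  refine ⟨d, hd, φ, fun k c hk hc => ?_, fun c hc => ?_⟩
  · have h1 : Continuous fun k' : ℝ => F (max k' 0) c := by
      have := hF.continuous_ext.comp (Continuous.prodMk_left c)
      simpa [Function.comp_def, max_eq_left hc] using this
    -- The assumed bound covers positive capital only; letting `k' ↓ k` extends the weak inequality
    -- to `k = 0`.
    have h2 : ∀ᶠ k' in 𝓝[>] k, -(d * k' + φ c) ≤ F (max k' 0) c := by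
      filter_upwards [self_mem_nhdsWithin] with k' hk'
      have hk0 : 0 < k' := hk.trans_lt hk'
      rw [max_eq_left hk0.le]
      linarith [hb k' c hk0 hc]
    have h3 := le_of_tendsto_of_tendsto
      (((by fun_prop : Continuous fun k' : ℝ => -(d * k' + φ c)).tendsto k).mono_left
        nhdsWithin_le_nhds) ((h1.tendsto k).mono_left nhdsWithin_le_nhds) h2
    simpa [max_eq_left hk] using h3
  · by_cases h1 : W = W₁
    · obtain ⟨d₂, hd₂, hφ⟩ := hlin h1
      subst h1
      refine ⟨fun t ht => ?_, fun T hT => ?_⟩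
      · simp only [hφ _ (hc.1 t ht)]
        exact mul_nonneg hd₂ (hc.1 t ht)
      · exact IntegrableOn.congr_fun ((hc.2 T hT).const_mul d₂)
          (fun t ht => (hφ _ (hc.1 t ht.1)).symm) measurableSet_Icc
    · have h2 := hW.resolve_left h1
      subst h2
      have hm : Monotone fun x => φ (max x 0) := fun x y hxy =>
        hmono.monotoneOn (mem_Ici.2 (le_max_right _ _)) (mem_Ici.2 (le_max_right _ _)) (max_le_max_right _ hxy)
      obtain ⟨h0, hmeas, hbd⟩ := hc
      refine ⟨fun t ht => ?_, ?_, fun T hT => ?_⟩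
      · rw [← hφ0]
        exact hmono.monotoneOn (le_refl (0 : ℝ)) (h0 t ht) (h0 t ht)
      · refine (hm.measurable.comp_aemeasurable hmeas).congr ?_
        filter_upwards [ae_restrict_mem measurableSet_Ici] with t ht
        simp [max_eq_left (h0 t ht)]
      · obtain ⟨M, hM⟩ := hbd T hT
        exact ⟨φ M, fun t ht => hmono.monotoneOn (h0 t ht.1) ((h0 t ht.1).trans (hM t ht))
          (hM t ht)⟩

/-- The technology grows at most linearly, and decays at least linearly in consumption. -/
lemma GrowthAssumption.exists_upper_bound (hG : GrowthAssumption ρ u F) :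
    ∃ A γ δ : ℝ, 0 ≤ A ∧ 0 < γ ∧ 0 < δ ∧ ∀ k c, 0 ≤ k → 0 ≤ c → F k c ≤ A + γ * k - δ * c := by
  obtain ⟨k₀, c₀, γ, δ, θ, a, b, C, hk₀, hc₀, hγ, hδ, -, -, -, hs, -⟩ := hG
  refine ⟨|F k₀ c₀ - γ * k₀ + δ * c₀|, γ, δ, abs_nonneg _, hγ, hδ, fun k c hk hc => ?_⟩
  have := hs k c hk hc
  have := le_abs_self (F k₀ c₀ - γ * k₀ + δ * c₀)
  linarith

/-- The consumption at which capital grows at rate `v`. -/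
noncomputable def techInv (F : ℝ → ℝ → ℝ) (k v : ℝ) : ℝ := sSup {a | 0 ≤ a ∧ v < F k a}

lemma techInv_nonneg (F : ℝ → ℝ → ℝ) (k v : ℝ) : 0 ≤ techInv F k v :=
  Real.sSup_nonneg fun _ ha => ha.1

/-- Since `F k` is continuous and strictly decreasing, with a linear upper bound that bounds its
superlevel sets, these sets are half-open intervals starting at `0`. An empty one is consistent with
the default `sSup ∅ = 0`. -/
lemma TechnologyAssumption.lt_techInv_iff (hF : TechnologyAssumption W F)
    (hG : GrowthAssumption ρ u F) {k v a : ℝ} (hk : 0 ≤ k) (ha : 0 ≤ a) :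
    a < techInv F k v ↔ v < F k a := by
  obtain ⟨A, γ, δ, hA, hγ, hδ, hb⟩ := hG.exists_upper_bound
  have hbdd : BddAbove {a | 0 ≤ a ∧ v < F k a} := by
    refine ⟨(A + γ * k - v) / δ, fun a' ha' => ?_⟩
    rw [le_div_iff₀ hδ]
    linarith [hb k a' hk ha'.1, ha'.2]
  constructor
  · intro h
    by_contra hv
    have : techInv F k v ≤ a := by
      refine Real.sSup_le (fun a' ha' => ?_) ha
      by_contra h'
      exact hv (ha'.2.trans (hF.decreasing_c k a a' hk ha (not_le.1 h')))
    linarith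
  · intro hv
    have h1 : Continuous fun c : ℝ => F k (max c 0) := by
      have := hF.continuous_ext.comp (Continuous.prodMk_right k)
      simpa [Function.comp_def, max_eq_left hk] using this
    have h2 : ∀ᶠ c in 𝓝[>] a, v < F k (max c 0) :=
      ((h1.tendsto a).mono_left nhdsWithin_le_nhds).eventually_const_lt (by simpa [ha] using hv)
    obtain ⟨c, hc1, hc2⟩ := (h2.and self_mem_nhdsWithin).exists
    have hac : a < c := hc2
    have hc0 : 0 ≤ c := ha.trans hac.le
    rw [max_eq_left hc0] at hc1
    exact hac.trans_le (le_csSup hbdd ⟨hc0, hc1⟩)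

/-- Slack can be consumed: raising consumption from `c` lowers the growth rate continuously until it
equals `v`. -/
lemma TechnologyAssumption.apply_techInv (hF : TechnologyAssumption W F)
    (hG : GrowthAssumption ρ u F) {k v c : ℝ} (hk : 0 ≤ k) (hc : 0 ≤ c) (hv : v ≤ F k c) :
    F k (techInv F k v) = v ∧ c ≤ techInv F k v := by
  have h0 := techInv_nonneg F k v
  have hcle : c ≤ techInv F k v := by
    by_contra h
    have h' := not_le.1 h
    exact lt_irrefl _ ((hF.lt_techInv_iff hG hk h0).2
      (hv.trans_lt (hF.decreasing_c k _ _ hk h0 h')))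
  refine ⟨le_antisymm ?_ ?_, hcle⟩
  · by_contra h
    exact lt_irrefl _ ((hF.lt_techInv_iff hG hk h0).2 (not_le.1 h))
  · rcases hcle.eq_or_lt with h | h
    · rw [← h]; exact hv
    have hpos : 0 < techInv F k v := hc.trans_lt h
    have h1 : Continuous fun c : ℝ => F k (max c 0) := by
      have := hF.continuous_ext.comp (Continuous.prodMk_right k)
      simpa [Function.comp_def, max_eq_left hk] using this
    have h2 : ∀ᶠ a in 𝓝[<] techInv F k v, v ≤ F k (max a 0) := by
      filter_upwards [Ioo_mem_nhdsLT hpos] with a ha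
      rw [max_eq_left ha.1.le]
      exact ((hF.lt_techInv_iff hG hk ha.1.le).1 ha.2).le
    have h3 := ge_of_tendsto ((h1.tendsto _).mono_left nhdsWithin_le_nhds) h2
    simpa [h0] using h3

/-- By `lt_techInv_iff`, for `a ≥ 0` the superlevel set of `techInv` at `a` is `{v < F(k, a)}`,
which is measurable by continuity of `F`. -/
lemma TechnologyAssumption.aemeasurable_techInv (hF : TechnologyAssumption W F)
    (hG : GrowthAssumption ρ u F) {k v : ℝ → ℝ} (hk : ContinuousOn k (Ici 0))
    (hk0 : ∀ t, 0 ≤ t → 0 ≤ k t) (hv : AEMeasurable v (volume.restrict (Ici 0))) :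
    AEMeasurable (fun t => techInv F (k t) (v t)) (volume.restrict (Ici 0)) := by
  have hkc : Continuous fun t => k (max t 0) :=
    hk.comp_continuous (by fun_prop) fun _ => mem_Ici.2 (le_max_right _ _)
  have hk0' : ∀ t, 0 ≤ k (max t 0) := fun t => hk0 _ (le_max_right _ _)
  refine ⟨fun t => techInv F (k (max t 0)) (hv.mk v t), ?_, ?_⟩
  · refine measurable_of_Ioi fun a => ?_
    rcases lt_or_ge a 0 with ha | ha
    · convert MeasurableSet.univ
      ext t
      simpa using ha.trans_le (techInv_nonneg _ _ _)
    · have : (fun t => techInv F (k (max t 0)) (hv.mk v t)) ⁻¹' Ioi a =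
          {t | hv.mk v t < F (k (max t 0)) a} := by
        ext t
        exact hF.lt_techInv_iff hG (hk0' t) ha
      rw [this]
      refine measurableSet_lt hv.measurable_mk (Continuous.measurable ?_)
      have := hF.continuous_ext.comp (hkc.prodMk (continuous_const (y := a)))
      simpa [Function.comp_def, hk0', ha] using this
  · filter_upwards [hv.ae_eq_mk, ae_restrict_mem measurableSet_Ici] with t ht ht0
    rw [← ht, max_eq_left ht0]

end Technology

/-! ### Relaxed trajectories and their relation to admissible pairs -/

/-- A relaxed trajectory on the time set `S`: capital grows at a rate `v` that is at most the one
permitted by the technology, and `w` is at most the utility obtained. -/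
structure FeasibleOn (S : Set ℝ) (ρ : ℝ) (W : Set (ℝ → ℝ)) (u : ℝ → ℝ → EReal) (F : ℝ → ℝ → ℝ)
    (x : ℝ) (k c v w : ℝ → ℝ) : Prop where
  integrable_v : ∀ T, 0 ≤ T → IntegrableOn v (Icc 0 T)
  eq_integral : ∀ t ∈ S, k t = x + ∫ s in (0 : ℝ)..t, v s
  nonneg_k : ∀ t ∈ S, 0 ≤ k t
  mem_class : c ∈ W
  -- This bound on disinvestment keeps the consumption recovered from `v` inside `W`.
  neg_v_le : ∃ g ∈ W, ∀ᵐ t ∂(volume.restrict (Ici (0 : ℝ))), -v t ≤ g t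
  v_le : ∀ᵐ t ∂(volume.restrict S), v t ≤ F (k t) (c t)
  w_le : ∀ᵐ t ∂(volume.restrict S), (w t : EReal) ≤ u (c t) (k t)
  integrable_w : IntegrableOn (fun t => Real.exp (-ρ * t) * w t) S

variable {ρ : ℝ} {W : Set (ℝ → ℝ)} {u : ℝ → ℝ → EReal} {F : ℝ → ℝ → ℝ} {x : ℝ} {k c v w : ℝ → ℝ}

lemma intervalIntegrable_of_Icc {f : ℝ → ℝ} (hf : ∀ T, 0 ≤ T → IntegrableOn f (Icc 0 T)) {a b : ℝ}
    (ha : 0 ≤ a) (hb : 0 ≤ b) : IntervalIntegrable f volume a b := by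
  rw [intervalIntegrable_iff]
  refine (hf (max a b) (ha.trans (le_max_left _ _))).mono_set fun t ht => ?_
  have h1 := ht.1
  have h2 := ht.2
  exact ⟨(le_min ha hb).trans h1.le, h2⟩

lemma locallyAC_of_eq_integral (hv : ∀ T, 0 ≤ T → IntegrableOn v (Icc 0 T))
    (hk : ∀ t, 0 ≤ t → k t = x + ∫ s in (0 : ℝ)..t, v s) : LocallyAC k := by
  intro T hT
  have h1 := (intervalIntegrable_of_Icc hv le_rfl hT).absolutelyContinuousOnInterval_intervalIntegral
    (c := 0) left_mem_uIcc
  have h2 : AbsolutelyContinuousOnInterval (fun _ : ℝ => x) 0 T :=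
    (contDiff_const.contDiffOn (n := 1)).absolutelyContinuousOnInterval
  have h3 := h2.add h1
  -- `k` is unconstrained at negative times, but only endpoints in `[0, T]` enter the definition.
  rw [absolutelyContinuousOnInterval_iff] at h3 ⊢
  intro ε hε
  obtain ⟨δ, hδ, H⟩ := h3 ε hε
  refine ⟨δ, hδ, fun E hE hl => ?_⟩
  convert H E hE hl using 1
  refine Finset.sum_congr rfl fun i hi => ?_
  have hmem := hE.1 i hi
  rw [uIcc_of_le hT] at hmem
  rw [hk _ hmem.1.1, hk _ hmem.2.1]
  rfl

lemma ae_hasDerivAt_of_eq_integral (hv : ∀ T, 0 ≤ T → IntegrableOn v (Icc 0 T))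
    (hk : ∀ t, 0 ≤ t → k t = x + ∫ s in (0 : ℝ)..t, v s) :
    ∀ᵐ t ∂(volume.restrict (Ici (0 : ℝ))), HasDerivAt k (v t) t := by
  have h1 : ∀ᵐ t : ℝ, ∀ n : ℕ, t ∈ uIcc (0 : ℝ) n →
      ∀ c ∈ uIcc (0 : ℝ) n, HasDerivAt (fun x => ∫ s in c..x, v s) (v t) t := by
    rw [ae_all_iff]
    intro n
    have := (intervalIntegrable_of_Icc hv le_rfl n.cast_nonneg).ae_hasDerivAt_integral
    filter_upwards [this] with t ht h using ht h
  rw [ae_restrict_iff' measurableSet_Ici]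
  -- The derivative is two-sided and `k` is known only on `[0, ∞)`, so `t = 0` is discarded.
  have h0 : ∀ᵐ t : ℝ, t ≠ 0 := by simp [ae_iff]
  filter_upwards [h1, h0] with t ht ht0 htn
  have htpos : 0 < t := lt_of_le_of_ne htn (Ne.symm ht0)
  obtain ⟨n, hn⟩ := exists_nat_ge t
  have h2 := (ht n (by rw [uIcc_of_le n.cast_nonneg]; exact ⟨htn, hn⟩) 0 left_mem_uIcc).const_add x
  refine h2.congr_of_eventuallyEq ?_
  filter_upwards [lt_mem_nhds htpos] with s hs
  exact hk s hs.le

lemma continuousOn_of_locallyAC (hk : LocallyAC k) : ContinuousOn k (Ici 0) := by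
  intro t ht
  have h1 := (hk (t + 1) (by linarith [mem_Ici.1 ht])).continuousOn
  rw [uIcc_of_le (by linarith [mem_Ici.1 ht])] at h1
  refine (h1 t ⟨ht, by linarith⟩).mono_of_mem_nhdsWithin ?_
  filter_upwards [self_mem_nhdsWithin, mem_nhdsWithin_of_mem_nhds (gt_mem_nhds (lt_add_one t))]
    with s hs1 hs2
  exact ⟨hs1, le_of_lt hs2⟩

lemma eq_integral_of_locallyAC (hk : LocallyAC k)
    (hd : ∀ᵐ t ∂(volume.restrict (Ici (0 : ℝ))), HasDerivAt k (v t) t) :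
    (∀ T, 0 ≤ T → IntegrableOn v (Icc 0 T)) ∧
      ∀ t, 0 ≤ t → k t = k 0 + ∫ s in (0 : ℝ)..t, v s := by
  rw [ae_restrict_iff' measurableSet_Ici] at hd
  have heq : ∀ T, 0 ≤ T → ∀ᵐ t, t ∈ uIoc 0 T → deriv k t = v t := by
    intro T hT
    filter_upwards [hd] with t ht h
    rw [uIoc_of_le hT] at h
    exact (ht h.1.le).deriv
  refine ⟨fun T hT => ?_, fun t ht => ?_⟩
  · rw [integrableOn_Icc_iff_integrableOn_Ioc, ← intervalIntegrable_iff_integrableOn_Ioc_of_le hT]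
    refine (hk T hT).intervalIntegrable_deriv.congr_ae ?_
    rw [EventuallyEq, ae_restrict_iff' measurableSet_uIoc]
    exact heq T hT
  · rw [← intervalIntegral.integral_congr_ae (heq t ht), (hk t ht).integral_deriv_eq_sub]
    ring

lemma FeasibleOn.locallyAC (h : FeasibleOn (Ici 0) ρ W u F x k c v w) : LocallyAC k :=
  locallyAC_of_eq_integral h.integrable_v fun t ht => h.eq_integral t ht

/-- A total utility is at least the discounted integral of any integrable minorant, and it can be
defined if there is one. -/
lemma integral_le_totalUtility
    (hw : ∀ᵐ t ∂(volume.restrict (Ici (0 : ℝ))), (w t : EReal) ≤ u (c t) (k t))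
    (hi : IntegrableOn (fun t => Real.exp (-ρ * t) * w t) (Ici 0)) :
    utilityNeg ρ u k c ≠ ⊤ ∧
      ((∫ t in Ici (0 : ℝ), Real.exp (-ρ * t) * w t : ℝ) : EReal) ≤ totalUtility ρ u k c := by
  set a := ∫⁻ t in Ici (0 : ℝ), ENNReal.ofReal (Real.exp (-ρ * t) * w t) with ha
  set b := ∫⁻ t in Ici (0 : ℝ), ENNReal.ofReal (-(Real.exp (-ρ * t) * w t)) with hb
  have hat : a ≠ ⊤ := (Integrable.lintegral_lt_top hi).ne
  have hbt : b ≠ ⊤ := (Integrable.lintegral_lt_top (Integrable.neg hi)).ne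
  have hpos : a ≤ utilityPos ρ u k c := by
    refine lintegral_mono_ae ?_
    filter_upwards [hw] with t ht
    rw [ENNReal.ofReal_mul (Real.exp_pos _).le]
    gcongr
    simpa using EReal.toENNReal_le_toENNReal ht
  have hneg : utilityNeg ρ u k c ≤ b := by
    refine lintegral_mono_ae ?_
    filter_upwards [hw] with t ht
    rw [← mul_neg, ENNReal.ofReal_mul (Real.exp_pos _).le]
    gcongr
    simpa using EReal.toENNReal_le_toENNReal (EReal.neg_le_neg_iff.2 ht)
  have hnt : utilityNeg ρ u k c ≠ ⊤ := ne_top_of_le_ne_top hbt hneg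
  refine ⟨hnt, ?_⟩
  rw [integral_eq_lintegral_pos_part_sub_lintegral_neg_part hi, EReal.coe_sub]
  rw [totalUtility]
  refine EReal.sub_le_sub ?_ ?_
  · rw [← ha, EReal.coe_ennreal_toReal hat]
    exact_mod_cast hpos
  · rw [← hb, EReal.coe_ennreal_toReal hbt]
    exact_mod_cast hneg

/-- A relaxed trajectory is dominated by an admissible pair. -/
theorem FeasibleOn.integral_le_valueFunction (hW : W = W₁ ∨ W = W₂) (hu : UtilityAssumption u)
    (hF : TechnologyAssumption W F) (hG : GrowthAssumption ρ u F)
    (h : FeasibleOn (Ici 0) ρ W u F x k c v w) :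
    ((∫ t in Ici (0 : ℝ), Real.exp (-ρ * t) * w t : ℝ) : EReal) ≤ valueFunction ρ W u F x := by
  obtain ⟨A, γ, δ, hA, hγ, hδ, hup⟩ := hG.exists_upper_bound
  obtain ⟨g, hg, hvg⟩ := h.neg_v_le
  have hk0 : ∀ t, 0 ≤ t → 0 ≤ k t := fun t ht => h.nonneg_k t ht
  have hc0 : ∀ t, 0 ≤ t → 0 ≤ c t := (class_subset hW h.mem_class).1
  have hkc := continuousOn_of_locallyAC h.locallyAC
  -- If `F(k, c') = v ≥ -g`, then the upper bound `F ≤ A + γ k - δ c'` forces `c' ≤ B`.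
  set B : ℝ → ℝ := fun t => δ⁻¹ * ((A + γ * k t) + g t) with hB
  have hBW : B ∈ W := by
    refine class_const_mul hW (inv_nonneg.2 hδ.le) (class_add hW ?_ hg)
    refine class_of_continuousOn hW (by fun_prop) fun t ht => ?_
    have := mul_nonneg hγ.le (hk0 t ht)
    linarith
  -- The inequality `techInv ≤ B` holds only almost everywhere, while local boundedness in `W₂` is
  -- pointwise; clipping at `B` repairs the exceptional null set.
  set c' : ℝ → ℝ := fun t => min (techInv F (k t) (v t)) (B t) with hc'
  have hc'W : c' ∈ W := by
    refine class_of_le hW hBW ?_ (fun t ht => ?_) fun t _ => min_le_right _ _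
    · exact (hF.aemeasurable_techInv hG hkc hk0 (aemeasurable_of_integrableOn_Icc h.integrable_v)).min
        (W₁_aemeasurable (class_subset hW hBW))
    · exact le_min (techInv_nonneg _ _ _) ((class_subset hW hBW).1 t ht)
  have hkey : ∀ᵐ t ∂(volume.restrict (Ici (0 : ℝ))), F (k t) (c' t) = v t ∧ c t ≤ c' t := by
    filter_upwards [hvg, h.v_le, ae_restrict_mem measurableSet_Ici] with t ht1 ht2 ht
    obtain ⟨h1, h2⟩ := hF.apply_techInv hG (hk0 t ht) (hc0 t ht) ht2
    have h3 : techInv F (k t) (v t) ≤ B t := by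
      have := hup (k t) (techInv F (k t) (v t)) (hk0 t ht) (techInv_nonneg _ _ _)
      rw [hB]
      simp only
      rw [inv_mul_eq_div, le_div_iff₀ hδ]
      linarith
    simp only [hc', min_eq_left h3]
    exact ⟨h1, h2⟩
  have hw : ∀ᵐ t ∂(volume.restrict (Ici (0 : ℝ))), (w t : EReal) ≤ u (c' t) (k t) := by
    filter_upwards [hkey, h.w_le, ae_restrict_mem measurableSet_Ici] with t ht1 ht2 ht
    exact ht2.trans (hu.monotone _ _ _ _ (hc0 t ht) ht1.2 (hk0 t ht) le_rfl)
  obtain ⟨h1, h2⟩ := integral_le_totalUtility (ρ := ρ) hw h.integrable_w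
  refine h2.trans (le_sSup ⟨k, c', ?_, rfl⟩)
  refine ⟨h.locallyAC, hc'W, hk0, (class_subset hW hc'W).1, Or.inr h1, ?_, ?_⟩
  · filter_upwards [hkey, ae_hasDerivAt_of_eq_integral h.integrable_v
      fun t ht => h.eq_integral t ht] with t ht1 ht2
    rw [ht1.1]
    exact ht2
  · simpa using h.eq_integral 0 (mem_Ici.2 le_rfl)

lemma aemeasurable_utility (hu : UtilityAssumption u) (hk : ContinuousOn k (Ici 0))
    (hk0 : ∀ t, 0 ≤ t → 0 ≤ k t) (hc : AEMeasurable c (volume.restrict (Ici 0)))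
    (hc0 : ∀ t, 0 ≤ t → 0 ≤ c t) :
    AEMeasurable (fun t => u (c t) (k t)) (volume.restrict (Ici 0)) := by
  have h1 := hu.continuous_ext.measurable.comp_aemeasurable
    (hc.prodMk (hk.aemeasurable measurableSet_Ici))
  refine h1.congr ?_
  filter_upwards [ae_restrict_mem measurableSet_Ici] with t ht
  simp [hk0 t ht, hc0 t ht]

/-- An admissible pair with a finite total utility, as a relaxed trajectory. -/
theorem Admissible.feasibleOn (hW : W = W₁ ∨ W = W₂) (hu : UtilityAssumption u)
    (hF : TechnologyAssumption W F) (h : Admissible ρ W u F x k c)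
    (hpos : utilityPos ρ u k c ≠ ⊤) (hneg : utilityNeg ρ u k c ≠ ⊤) :
    (∀ᵐ t ∂(volume.restrict (Ici (0 : ℝ))), u (c t) (k t) = ((u (c t) (k t)).toReal : EReal)) ∧
      FeasibleOn (Ici 0) ρ W u F x k c (fun t => F (k t) (c t))
        (fun t => (u (c t) (k t)).toReal) ∧
      totalUtility ρ u k c
        = ((∫ t in Ici (0 : ℝ), Real.exp (-ρ * t) * (u (c t) (k t)).toReal : ℝ) : EReal) := by
  have hkc := continuousOn_of_locallyAC h.locallyAC
  have hm := aemeasurable_utility hu hkc h.nonneg_k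
    (W₁_aemeasurable (class_subset hW h.mem_class)) h.nonneg_c
  have hexp : AEMeasurable (fun t : ℝ => ENNReal.ofReal (Real.exp (-ρ * t)))
      (volume.restrict (Ici 0)) := by fun_prop
  have hne : ∀ᵐ t ∂(volume.restrict (Ici (0 : ℝ))),
      u (c t) (k t) = ((u (c t) (k t)).toReal : EReal) := by
    have h1 := ae_lt_top' (hexp.mul (measurable_ereal_toENNReal.comp_aemeasurable hm.neg)) hneg
    filter_upwards [h1, ae_restrict_mem measurableSet_Ici] with t ht ht0
    rw [EReal.coe_toReal (hu.ne_top _ _ (h.nonneg_c t ht0) (h.nonneg_k t ht0))]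
    intro hbot
    simp [hbot, ENNReal.mul_top, Real.exp_pos] at ht
  have hint : IntegrableOn (fun t => Real.exp (-ρ * t) * (u (c t) (k t)).toReal) (Ici 0) := by
    refine ⟨AEMeasurable.aestronglyMeasurable
      (((by fun_prop : Measurable fun t : ℝ => Real.exp (-ρ * t)).aemeasurable).mul
        (measurable_ereal_toReal.comp_aemeasurable hm)), ?_⟩
    rw [hasFiniteIntegral_iff_norm]
    have hsum : utilityPos ρ u k c + utilityNeg ρ u k c < ⊤ :=
      ENNReal.add_lt_top.2 ⟨lt_top_iff_ne_top.2 hpos, lt_top_iff_ne_top.2 hneg⟩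
    have hposm : AEMeasurable (fun t => ENNReal.ofReal (Real.exp (-ρ * t)) *
        (u (c t) (k t)).toENNReal) (volume.restrict (Ici 0)) :=
      hexp.mul (measurable_ereal_toENNReal.comp_aemeasurable hm)
    rw [utilityPos, utilityNeg, ← lintegral_add_left' hposm] at hsum
    refine lt_of_le_of_lt (lintegral_mono_ae ?_) hsum
    filter_upwards [hne] with t ht
    rw [norm_mul, Real.norm_of_nonneg (Real.exp_pos _).le, ENNReal.ofReal_mul (Real.exp_pos _).le,
      Real.norm_eq_abs, ht, ← EReal.coe_neg, EReal.real_coe_toENNReal, EReal.real_coe_toENNReal,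
      EReal.toReal_coe, ← mul_add]
    gcongr
    rcases le_total 0 (u (c t) (k t)).toReal with h' | h'
    · rw [abs_of_nonneg h']; exact le_self_add
    · rw [abs_of_nonpos h']; exact le_add_self
  obtain ⟨hv1, hv2⟩ := eq_integral_of_locallyAC h.locallyAC h.hasDerivAt
  obtain ⟨d, hd, φ, hlow, hφ⟩ := hF.exists_lower_bound hW
  refine ⟨hne, ⟨hv1, fun t ht => ?_, fun t ht => h.nonneg_k t ht, h.mem_class,
    ⟨fun t => d * k t + φ (c t), class_add hW ?_ (hφ c h.mem_class), ?_⟩, ?_, ?_, hint⟩, ?_⟩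
  · rw [hv2 t ht, h.initial]
  · exact class_of_continuousOn hW (by fun_prop) fun t ht => mul_nonneg hd.le (h.nonneg_k t ht)
  · filter_upwards [ae_restrict_mem measurableSet_Ici] with t ht
    linarith [hlow (k t) (c t) (h.nonneg_k t ht) (h.nonneg_c t ht)]
  · exact ae_of_all _ fun t => le_rfl
  · filter_upwards [hne] with t ht
    exact ht.symm.le
  · have hfin : (∫⁻ t in Ici (0 : ℝ),
        ENNReal.ofReal (-(Real.exp (-ρ * t) * (u (c t) (k t)).toReal))) ≠ ⊤ :=
      (Integrable.lintegral_lt_top (Integrable.neg hint)).ne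
    rw [integral_eq_lintegral_pos_part_sub_lintegral_neg_part hint, EReal.coe_sub, totalUtility,
      EReal.coe_ennreal_toReal (Integrable.lintegral_lt_top hint).ne,
      EReal.coe_ennreal_toReal hfin]
    congr 2
    · refine lintegral_congr_ae ?_
      filter_upwards [hne] with t ht
      rw [ENNReal.ofReal_mul (Real.exp_pos _).le, ht]
      simp
    · refine lintegral_congr_ae ?_
      filter_upwards [hne] with t ht
      rw [← mul_neg, ENNReal.ofReal_mul (Real.exp_pos _).le, ht, ← EReal.coe_neg]
      simp

/-! ### Growth estimates and finiteness of the value -/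

lemma crra_le_log {θ z : ℝ} (hθ : 1 ≤ θ) (hz : 1 ≤ z) : crra θ z ≤ Real.log z := by
  rw [crra]
  split_ifs with h
  · exact le_rfl
  have hθ' : 1 < θ := lt_of_le_of_ne hθ (Ne.symm h)
  rw [div_le_iff_of_neg (by linarith), Real.rpow_def_of_pos (by linarith)]
  linarith [Real.add_one_le_exp (Real.log z * (1 - θ))]

/-- Constant relative risk aversion utility grows at most like a small enough power. -/
lemma exists_crra_le_rpow {θ γ : ℝ} (hρ : 0 < ρ) (hθ : 0 < θ) (hγ : 0 < γ)
    (h : 0 < ρ - (1 - θ) * γ) :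
    ∃ η : ℝ, 0 < η ∧ η ≤ 1 ∧ 0 < ρ - η * γ ∧ ∀ z, 1 ≤ z → crra θ z ≤ z ^ η / η := by
  rcases lt_or_ge θ 1 with h1 | h1
  · refine ⟨1 - θ, by linarith, by linarith, h, fun z hz => ?_⟩
    rw [crra, if_neg h1.ne]
    gcongr
    linarith
  -- For `θ ≥ 1` the utility is at most logarithmic, so any small power will do; this exponent keeps
  -- `ρ - η γ ≥ ρ / 2`.
  · refine ⟨min 1 (ρ / (2 * γ)), by positivity, min_le_left _ _, ?_, fun z hz => ?_⟩
    · have : min 1 (ρ / (2 * γ)) * γ ≤ ρ / (2 * γ) * γ := by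
        gcongr
        exact min_le_right _ _
      have h2 : ρ / (2 * γ) * γ = ρ / 2 := by field_simp
      linarith
    · exact (crra_le_log h1 hz).trans (Real.log_le_rpow_div (by linarith) (by positivity))

/-- With `y = z e^{-γt}` the discount rate becomes `ρ - ηγ`, and `y ^ η ≤ 1 + y` because `0 < η ≤
1`. -/
lemma exp_mul_rpow_le {η γ z t : ℝ} (hη : 0 < η) (hη1 : η ≤ 1) (hz : 0 ≤ z) :
    Real.exp (-ρ * t) * z ^ η ≤ Real.exp (-(ρ - η * γ) * t) * (1 + z * Real.exp (-γ * t)) := by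
  have hy : 0 ≤ z * Real.exp (-γ * t) := by positivity
  have h1 : (z * Real.exp (-γ * t)) ^ η ≤ 1 + z * Real.exp (-γ * t) := by
    rcases le_total (z * Real.exp (-γ * t)) 1 with h | h
    · linarith [Real.rpow_le_one hy h hη.le]
    · have := Real.rpow_le_rpow_of_exponent_le h hη1
      rw [Real.rpow_one] at this
      linarith
  have h2 : Real.exp (-ρ * t) * z ^ η
      = Real.exp (-(ρ - η * γ) * t) * (z * Real.exp (-γ * t)) ^ η := by
    rw [Real.mul_rpow hz (Real.exp_pos _).le, ← Real.exp_mul]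
    have : Real.exp (-ρ * t) = Real.exp (-(ρ - η * γ) * t) * Real.exp (-γ * t * η) := by
      rw [← Real.exp_add]
      ring_nf
    rw [this]
    ring
  rw [h2]
  gcongr

/-- Discounted at the growth rate `γ` of the technology, capital and accumulated consumption stay
bounded. -/
lemma capital_add_consumption_le {A γ δ : ℝ} (hγ : 0 < γ)
    (hup : ∀ k c, 0 ≤ k → 0 ≤ c → F k c ≤ A + γ * k - δ * c)
    (hv : ∀ T, 0 ≤ T → IntegrableOn v (Icc 0 T))
    (hk : ∀ t, 0 ≤ t → k t = x + ∫ s in (0 : ℝ)..t, v s) (hk0 : ∀ t, 0 ≤ t → 0 ≤ k t)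
    (hc : c ∈ W₁) (hvF : ∀ᵐ t ∂(volume.restrict (Ici (0 : ℝ))), v t ≤ F (k t) (c t))
    {T : ℝ} (hT : 0 ≤ T) :
    (k T + A / γ) * Real.exp (-γ * T) + δ * ∫ t in (0 : ℝ)..T, c t * Real.exp (-γ * t)
      ≤ x + A / γ := by
  -- The shift by `A / γ` absorbs the constant: `A + γ k = γ (k + A / γ)`. The derivative of `(k + A
  -- / γ) e^{-γt}` is then at most `-δ c e^{-γt}`, and integration gives the claim.
  have hac : AbsolutelyContinuousOnInterval (fun t => k t + A / γ) 0 T := by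
    have h1 := locallyAC_of_eq_integral hv hk T hT
    have h2 : AbsolutelyContinuousOnInterval (fun _ : ℝ => A / γ) 0 T :=
      (contDiff_const.contDiffOn (n := 1)).absolutelyContinuousOnInterval
    exact h1.add h2
  have hg : AbsolutelyContinuousOnInterval (fun t : ℝ => Real.exp (-γ * t)) 0 T :=
    ContDiffOn.absolutelyContinuousOnInterval (by fun_prop)
  have hgd : ∀ t : ℝ, deriv (fun t : ℝ => Real.exp (-γ * t)) t = -γ * Real.exp (-γ * t) := by
    intro t
    have := ((hasDerivAt_id t).const_mul (-γ)).exp.deriv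
    simp only [id] at this
    rw [this]
    ring
  have hparts := hac.integral_deriv_mul_eq_sub hg
  have hcI : IntervalIntegrable (fun t => c t * Real.exp (-γ * t)) volume 0 T :=
    (intervalIntegrable_of_Icc hc.2 le_rfl hT).mul_continuousOn (by fun_prop)
  have hdk := ae_hasDerivAt_of_eq_integral hv hk
  have hle : ∫ t in (0 : ℝ)..T, (deriv (fun t => k t + A / γ) t * Real.exp (-γ * t)
      + (k t + A / γ) * deriv (fun t : ℝ => Real.exp (-γ * t)) t)
      ≤ ∫ t in (0 : ℝ)..T, -δ * (c t * Real.exp (-γ * t)) := by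
    refine intervalIntegral.integral_mono_ae_restrict hT ?_ (hcI.const_mul _) ?_
    · exact (hac.intervalIntegrable_deriv.mul_continuousOn hg.continuousOn).add
        (hg.intervalIntegrable_deriv.continuousOn_mul hac.continuousOn)
    · refine ae_restrict_of_ae_restrict_of_subset Icc_subset_Ici_self ?_
      filter_upwards [hdk, hvF, ae_restrict_mem measurableSet_Ici] with t h1 h2 ht
      rw [(h1.add_const (A / γ)).deriv, hgd]
      have h3 := hup (k t) (c t) (hk0 t ht) (hc.1 t ht)
      have h4 : v t - γ * (k t + A / γ) ≤ -δ * c t := by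
        have : γ * (k t + A / γ) = γ * k t + A := by field_simp
        linarith
      have := mul_le_mul_of_nonneg_right h4 (Real.exp_pos (-γ * t)).le
      linarith
  rw [hparts, intervalIntegral.integral_const_mul, hk 0 le_rfl] at hle
  simp at hle
  simp
  linarith

lemma integrableOn_discounted_consumption {γ K : ℝ} (hc : c ∈ W₁)
    (h : ∀ T, 0 ≤ T → ∫ t in (0 : ℝ)..T, c t * Real.exp (-γ * t) ≤ K) :
    IntegrableOn (fun t => c t * Real.exp (-γ * t)) (Ici 0) ∧
      ∫ t in Ici (0 : ℝ), c t * Real.exp (-γ * t) ≤ K := by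
  have hcI : ∀ T, 0 ≤ T → IntegrableOn (fun t => c t * Real.exp (-γ * t)) (Ioc 0 T) := by
    intro T hT
    rw [← intervalIntegrable_iff_integrableOn_Ioc_of_le hT]
    exact (intervalIntegrable_of_Icc hc.2 le_rfl hT).mul_continuousOn (by fun_prop)
  have hint : IntegrableOn (fun t => c t * Real.exp (-γ * t)) (Ioi 0) := by
    refine integrableOn_Ioi_of_intervalIntegral_norm_bounded K 0 (l := atTop) (b := fun n : ℕ => (n : ℝ))
      (fun n => hcI n n.cast_nonneg) tendsto_natCast_atTop_atTop (Eventually.of_forall fun n => ?_)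
    refine le_trans (le_of_eq ?_) (h n n.cast_nonneg)
    refine intervalIntegral.integral_congr fun t ht => ?_
    rw [uIcc_of_le n.cast_nonneg] at ht
    exact Real.norm_of_nonneg (mul_nonneg (hc.1 t ht.1) (Real.exp_pos _).le)
  refine ⟨(integrableOn_Ici_iff_integrableOn_Ioi).2 hint, ?_⟩
  rw [integral_Ici_eq_integral_Ioi]
  refine le_of_tendsto (intervalIntegral_tendsto_integral_Ioi 0 hint tendsto_natCast_atTop_atTop)
    (Eventually.of_forall fun n : ℕ => h n n.cast_nonneg)

/-- Along relaxed trajectories discounted utility has an integrable majorant, whose integral is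
bounded in terms of the initial capital stock. -/
lemma GrowthAssumption.exists_majorant (hρ : 0 < ρ) (hu : UtilityAssumption u)
    (hG : GrowthAssumption ρ u F) (x : ℝ) :
    ∃ M : ℝ, ∀ k c v : ℝ → ℝ, (∀ T, 0 ≤ T → IntegrableOn v (Icc 0 T)) →
      (∀ t, 0 ≤ t → k t = x + ∫ s in (0 : ℝ)..t, v s) → (∀ t, 0 ≤ t → 0 ≤ k t) → c ∈ W₁ →
      (∀ᵐ t ∂(volume.restrict (Ici (0 : ℝ))), v t ≤ F (k t) (c t)) →
      ∃ b : ℝ → ℝ, IntegrableOn b (Ici 0) ∧ (∀ t, 0 ≤ t → 0 ≤ b t) ∧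
        (∀ t, 0 ≤ t → u (c t) (k t) ≤ ((Real.exp (ρ * t) * b t : ℝ) : EReal)) ∧
        ∫ t in Ici (0 : ℝ), b t ≤ M := by
  obtain ⟨k₀, c₀, γ, δ, θ, a, b, C, hk₀, hc₀, hγ, hδ, hθ, ha, hb, hs, hργ, hub⟩ := hG
  obtain ⟨η, hη, hη1, hε, hcrra⟩ := exists_crra_le_rpow hρ hθ hγ hργ
  set ε := ρ - η * γ with hεdef
  set A := |F k₀ c₀ - γ * k₀ + δ * c₀| with hAdef
  have hA : 0 ≤ A := abs_nonneg _
  have hup : ∀ k c, 0 ≤ k → 0 ≤ c → F k c ≤ A + γ * k - δ * c := by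
    intro k c hk hc
    have := hs k c hk hc
    have := le_abs_self (F k₀ c₀ - γ * k₀ + δ * c₀)
    linarith
  set K := x + A / γ with hK
  -- `N` collects the coefficients of `e^{-εt}`: the constant part of the consumption term, the
  -- capital term with `k e^{-γt} ≤ K`, and `|C|`. The remaining consumption term integrates to at
  -- most `K / δ`.
  set N := a / η * 2 + (b / η * (2 + K) + |C|) with hN
  refine ⟨a / η * (K / δ) + N * (1 / ε), fun k c v hv hk hk0 hc hvF => ?_⟩
  have hest := fun T (hT : 0 ≤ T) => capital_add_consumption_le hγ hup hv hk hk0 hc hvF hT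
  have hAγ : 0 ≤ A / γ := by positivity
  have hcpos : ∀ T, 0 ≤ T → 0 ≤ ∫ t in (0 : ℝ)..T, c t * Real.exp (-γ * t) := fun T hT =>
    intervalIntegral.integral_nonneg hT fun t ht => mul_nonneg (hc.1 t ht.1) (Real.exp_pos _).le
  have hkK : ∀ t, 0 ≤ t → k t * Real.exp (-γ * t) ≤ K := by
    intro t ht
    have h1 := hest t ht
    have h2 := mul_nonneg hδ.le (hcpos t ht)
    have h3 := mul_nonneg hAγ (Real.exp_pos (-γ * t)).le
    linarith
  have hK0 : 0 ≤ K := (mul_nonneg (hk0 0 le_rfl) (Real.exp_pos _).le).trans (hkK 0 le_rfl)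
  obtain ⟨hcI, hcK⟩ := integrableOn_discounted_consumption (γ := γ) (K := K / δ) hc fun T hT => by
    rw [le_div_iff₀ hδ]
    have h1 := hest T hT
    have h2 := mul_nonneg (hk0 T hT) (Real.exp_pos (-γ * T)).le
    have h3 := mul_nonneg hAγ (Real.exp_pos (-γ * T)).le
    linarith
  have hN0 : 0 ≤ N := by positivity
  have hexpI : IntegrableOn (fun t => Real.exp (-ε * t)) (Ici 0) :=
    (integrableOn_Ici_iff_integrableOn_Ioi).2 (integrableOn_exp_mul_Ioi (by linarith) 0)
  have hexpE : ∫ t in Ici (0 : ℝ), Real.exp (-ε * t) = 1 / ε := by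
    rw [integral_Ici_eq_integral_Ioi, integral_exp_mul_Ioi (by linarith)]
    simp
  refine ⟨fun t => a / η * (c t * Real.exp (-γ * t)) + N * Real.exp (-ε * t),
    (hcI.const_mul _).add (hexpI.const_mul _), fun t ht => ?_, fun t ht => ?_, ?_⟩
  · have := hc.1 t ht
    positivity
  · have hct := hc.1 t ht
    have hkt := hk0 t ht
    -- Raising both arguments by `1` makes them positive, as the growth bound requires, and at least
    -- `1`, as the power bound requires.
    refine (hu.monotone _ (c t + 1) _ (k t + 1) hct (by linarith) hkt (by linarith)).trans ?_
    refine (hub _ _ (by linarith) (by linarith)).trans (EReal.coe_le_coe_iff.2 ?_)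
    have hg1 : Real.exp (-γ * t) ≤ 1 := Real.exp_le_one_iff.2 (by nlinarith)
    have he1 : Real.exp (-ε * t) ≤ 1 := Real.exp_le_one_iff.2 (by nlinarith)
    have hz : ∀ z, 0 ≤ z → Real.exp (-ρ * t) * crra θ (z + 1)
        ≤ Real.exp (-ε * t) * (2 + z * Real.exp (-γ * t)) / η := by
      intro z hz
      calc Real.exp (-ρ * t) * crra θ (z + 1)
          ≤ Real.exp (-ρ * t) * ((z + 1) ^ η / η) := by
            gcongr
            exact hcrra _ (by linarith)
        _ = Real.exp (-ρ * t) * (z + 1) ^ η / η := by ring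
        _ ≤ Real.exp (-ε * t) * (1 + (z + 1) * Real.exp (-γ * t)) / η := by
            exact div_le_div_of_nonneg_right (exp_mul_rpow_le hη hη1 (by linarith)) hη.le
        _ ≤ Real.exp (-ε * t) * (2 + z * Real.exp (-γ * t)) / η := by
            refine div_le_div_of_nonneg_right (mul_le_mul_of_nonneg_left ?_ (Real.exp_pos _).le) hη.le
            linarith
    have h1 : a * (Real.exp (-ρ * t) * crra θ (c t + 1))
        ≤ a / η * (c t * Real.exp (-γ * t)) + a / η * 2 * Real.exp (-ε * t) := by
      calc a * (Real.exp (-ρ * t) * crra θ (c t + 1))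
          ≤ a * (Real.exp (-ε * t) * (2 + c t * Real.exp (-γ * t)) / η) := by
            gcongr
            exact hz _ hct
        _ = a / η * (Real.exp (-ε * t) * (c t * Real.exp (-γ * t)))
              + a / η * 2 * Real.exp (-ε * t) := by ring
        _ ≤ a / η * (1 * (c t * Real.exp (-γ * t))) + a / η * 2 * Real.exp (-ε * t) := by
            gcongr
        _ = _ := by ring
    have h2 : b * (Real.exp (-ρ * t) * crra θ (k t + 1))
        ≤ b / η * (2 + K) * Real.exp (-ε * t) := by
      calc b * (Real.exp (-ρ * t) * crra θ (k t + 1))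
          ≤ b * (Real.exp (-ε * t) * (2 + k t * Real.exp (-γ * t)) / η) := by
            gcongr
            exact hz _ hkt
        _ ≤ b * (Real.exp (-ε * t) * (2 + K) / η) := by
            gcongr
            exact hkK t ht
        _ = _ := by ring
    have h3 : Real.exp (-ρ * t) * C ≤ |C| * Real.exp (-ε * t) := by
      rw [mul_comm]
      gcongr
      · exact le_abs_self C
      · nlinarith [mul_nonneg hη.le hγ.le]
    have h4 : Real.exp (-ρ * t) * (a * crra θ (c t + 1) + b * crra θ (k t + 1) + C)
        ≤ a / η * (c t * Real.exp (-γ * t)) + N * Real.exp (-ε * t) := by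
      rw [hN]
      linarith
    have h5 := mul_le_mul_of_nonneg_left h4 (Real.exp_pos (ρ * t)).le
    rwa [← mul_assoc, ← Real.exp_add, neg_mul, add_neg_cancel, Real.exp_zero, one_mul] at h5
  · rw [integral_add (hcI.const_mul _) (hexpI.const_mul _), integral_const_mul, integral_const_mul,
      hexpE]
    gcongr

/-- The positive part of total utility is finite for admissible pairs. -/
lemma Admissible.utilityPos_ne_top (hρ : 0 < ρ) (hW : W = W₁ ∨ W = W₂) (hu : UtilityAssumption u)
    (hG : GrowthAssumption ρ u F) (h : Admissible ρ W u F x k c) : utilityPos ρ u k c ≠ ⊤ := by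
  obtain ⟨M, hM⟩ := hG.exists_majorant hρ hu x
  obtain ⟨hv1, hv2⟩ := eq_integral_of_locallyAC h.locallyAC h.hasDerivAt
  obtain ⟨b, hb, hb0, hub, -⟩ := hM k c _ hv1 (by rw [← h.initial]; exact hv2) h.nonneg_k
    (class_subset hW h.mem_class) (ae_of_all _ fun _ => le_rfl)
  refine ne_top_of_le_ne_top (Integrable.lintegral_lt_top hb).ne (lintegral_mono_ae ?_)
  filter_upwards [ae_restrict_mem measurableSet_Ici] with t ht
  have h1 := EReal.toENNReal_le_toENNReal (hub t ht)
  rw [EReal.real_coe_toENNReal] at h1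
  calc _ ≤ ENNReal.ofReal (Real.exp (-ρ * t)) * ENNReal.ofReal (Real.exp (ρ * t) * b t) := by gcongr
    _ = ENNReal.ofReal (b t) := by
      rw [← ENNReal.ofReal_mul (Real.exp_pos _).le, ← mul_assoc, ← Real.exp_add]
      simp

lemma FeasibleOn.exists_integral_le (hρ : 0 < ρ) (hW : W = W₁ ∨ W = W₂) (hu : UtilityAssumption u)
    (hG : GrowthAssumption ρ u F) (x : ℝ) :
    ∃ M : ℝ, ∀ k c v w, FeasibleOn (Ici 0) ρ W u F x k c v w →
      ∫ t in Ici (0 : ℝ), Real.exp (-ρ * t) * w t ≤ M := by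
  obtain ⟨M, hM⟩ := hG.exists_majorant hρ hu x
  refine ⟨M, fun k c v w h => ?_⟩
  obtain ⟨b, hb, -, hub, hbM⟩ := hM k c v h.integrable_v (fun t ht => h.eq_integral t ht)
    (fun t ht => h.nonneg_k t ht) (class_subset hW h.mem_class) h.v_le
  refine le_trans (integral_mono_ae h.integrable_w hb ?_) hbM
  filter_upwards [h.w_le, ae_restrict_mem measurableSet_Ici] with t ht ht0
  have h1 := EReal.coe_le_coe_iff.1 (ht.trans (hub t ht0))
  have h2 := mul_le_mul_of_nonneg_left h1 (Real.exp_pos (-ρ * t)).le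
  rwa [← mul_assoc, ← Real.exp_add, neg_mul, neg_add_cancel, Real.exp_zero, one_mul,
    ← neg_mul] at h2

/-- The set of values of relaxed trajectories. -/
def feasibleValues (ρ : ℝ) (W : Set (ℝ → ℝ)) (u : ℝ → ℝ → EReal) (F : ℝ → ℝ → ℝ) (x : ℝ) : Set ℝ :=
  {r | ∃ k c v w, FeasibleOn (Ici 0) ρ W u F x k c v w ∧
    r = ∫ t in Ici (0 : ℝ), Real.exp (-ρ * t) * w t}

/-- The value function is the supremum of the values of relaxed trajectories. -/
theorem isLUB_valueFunction (hρ : 0 < ρ) (hW : W = W₁ ∨ W = W₂) (hu : UtilityAssumption u)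
    (hF : TechnologyAssumption W F) (hG : GrowthAssumption ρ u F)
    (hne : (feasibleValues ρ W u F x).Nonempty) :
    ∃ V : ℝ, valueFunction ρ W u F x = V ∧ IsLUB (feasibleValues ρ W u F x) V := by
  obtain ⟨M, hM⟩ := FeasibleOn.exists_integral_le hρ hW hu hG x
  have hbdd : BddAbove (feasibleValues ρ W u F x) := by
    refine ⟨M, ?_⟩
    rintro r ⟨k, c, v, w, h, rfl⟩
    exact hM k c v w h
  have hlub := isLUB_csSup hne hbdd
  refine ⟨_, le_antisymm (sSup_le ?_) ?_, hlub⟩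
  · rintro J ⟨k, c, h, rfl⟩
    -- In `EReal` subtracting `⊤` always gives `⊥`, so such pairs do not matter for the supremum.
    by_cases hneg : utilityNeg ρ u k c = ⊤
    · have : totalUtility ρ u k c = ⊥ := by
        rw [totalUtility, hneg, EReal.coe_ennreal_top, EReal.sub_top]
      rw [this]
      exact bot_le
    · obtain ⟨-, h1, h2⟩ := h.feasibleOn hW hu hF (h.utilityPos_ne_top hρ hW hu hG) hneg
      rw [h2, EReal.coe_le_coe_iff]
      exact hlub.1 ⟨k, c, _, _, h1, rfl⟩
  · have : ∀ r ∈ feasibleValues ρ W u F x, (r : EReal) ≤ valueFunction ρ W u F x := by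
      rintro r ⟨k, c, v, w, h, rfl⟩
      exact h.integral_le_valueFunction hW hu hF hG
    by_contra hlt
    obtain ⟨r0, hr0⟩ := hne
    obtain ⟨q, hq1, hq2⟩ := EReal.lt_iff_exists_real_btwn.1 (not_le.1 hlt)
    obtain ⟨r, hr, hqr⟩ := (lt_isLUB_iff hlub).1 (EReal.coe_lt_coe_iff.1 hq2)
    exact absurd ((this r hr).trans_lt hq1) (by simpa using hqr.le)

/-! ### Existence and convex combinations of relaxed trajectories -/

lemma UtilityAssumption.coe_toReal (hu : UtilityAssumption u) {c k : ℝ} (hc : 0 < c) (hk : 0 < k) :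
    ((u c k).toReal : EReal) = u c k := by
  refine EReal.coe_toReal (hu.ne_top c k hc.le hk.le) ?_
  have := hu.increasing_c (c / 2) c k (by linarith) (by linarith) hk
  exact (bot_le.trans_lt this).ne'

lemma mem_quadrant {a b : ℝ} (ha : 0 ≤ a) (hb : 0 ≤ b) : ((a, b) : ℝ × ℝ) ∈ Quadrant := ⟨ha, hb⟩

lemma TechnologyAssumption.combo_le (hF : TechnologyAssumption W F) {k₁ c₁ k₂ c₂ a b : ℝ}
    (hk₁ : 0 ≤ k₁) (hc₁ : 0 ≤ c₁) (hk₂ : 0 ≤ k₂) (hc₂ : 0 ≤ c₂) (ha : 0 ≤ a) (hb : 0 ≤ b)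
    (hab : a + b = 1) :
    a * F k₁ c₁ + b * F k₂ c₂ ≤ F (a * k₁ + b * k₂) (a * c₁ + b * c₂) := by
  simpa using hF.concaveOn.2 (mem_quadrant hk₁ hc₁) (mem_quadrant hk₂ hc₂) ha hb hab

/-- The slopes of the technology in capital are uniformly bounded below. -/
lemma TechnologyAssumption.exists_slope_bound (hW : W = W₁ ∨ W = W₂)
    (hF : TechnologyAssumption W F) :
    ∃ d : ℝ, 0 < d ∧ ∀ k h c, 0 ≤ k → 0 ≤ h → 0 ≤ c → F k c - d * h ≤ F (k + h) c := by
  obtain ⟨d, hd, φ, hlow, -⟩ := hF.exists_lower_bound hW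
  refine ⟨d, hd, fun k h c hk hh hc => ?_⟩
  rcases hh.eq_or_lt with rfl | hh0
  · simp
  by_contra hlt
  have hlt := not_le.1 hlt
  set e := F k c - d * h - F (k + h) c with he
  have he0 : 0 < e := by linarith
  set D := F k c + d * k + φ c with hD
  have hD0 : 0 ≤ D := by linarith [hlow k c hk hc]
  -- If the slope bound failed by `e`, concavity would keep `F` below the steep chord up to `k + s`.
  -- The slack of the linear minorant at `k` is `D`, and `s` is chosen with `s e > h D`, so the
  -- minorant is violated there.
  set s := h + h * D / e + 1 with hs
  have hq : 0 ≤ h * D / e := by positivity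
  have hs0 : 0 < s := by linarith
  have hsh : h ≤ s := by linarith
  have h1 := hF.combo_le (a := 1 - h / s) (b := h / s) hk hc (by linarith : 0 ≤ k + s) hc
    (by rw [sub_nonneg, div_le_one hs0]; exact hsh) (by positivity) (by ring)
  have h2 : (1 - h / s) * k + h / s * (k + s) = k + h := by field_simp; ring
  have h3 : (1 - h / s) * c + h / s * c = c := by ring
  rw [h2, h3] at h1
  have h4 := mul_le_mul_of_nonneg_left (hlow (k + s) c (by linarith) hc)
    (by positivity : 0 ≤ h / s)
  have h5 : h / s * (d * s) = d * h := by field_simp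
  have h6 : e ≤ h / s * D := by
    rw [he, hD]
    linarith
  have h7 : h * D < e * s := by
    have : e * (h * D / e) = h * D := by field_simp
    nlinarith
  rw [div_mul_eq_mul_div, le_div_iff₀ hs0] at h6
  linarith

/-- Small capital stocks sustain a positive consumption. -/
lemma TechnologyAssumption.exists_sustainable (hF : TechnologyAssumption W F) {y : ℝ} (hy : 0 < y) :
    ∃ k₁ c₁ : ℝ, 0 < k₁ ∧ k₁ ≤ y ∧ 0 < c₁ ∧ 0 ≤ F k₁ c₁ := by
  obtain ⟨k₂, hk₂, h₂⟩ := hF.productive 0 le_rfl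
  rw [hF.zero] at h₂
  have hk : 0 < min k₂ y := lt_min hk₂ hy
  have hq : min k₂ y / k₂ ≤ 1 := (div_le_one hk₂).2 (min_le_left _ _)
  -- Concavity on the segment from `(0, 0)` to `(k₂, 0)` makes `F(·, 0)` positive at `min k₂ y`;
  -- continuity then leaves room for some consumption.
  have h1 := hF.combo_le (a := 1 - min k₂ y / k₂) (b := min k₂ y / k₂) le_rfl le_rfl hk₂.le le_rfl
    (by linarith) (by positivity) (by ring)
  have h2 : (1 - min k₂ y / k₂) * 0 + min k₂ y / k₂ * k₂ = min k₂ y := by field_simp; ring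
  rw [h2, hF.zero] at h1
  have h3 : 0 < F (min k₂ y) 0 := by
    have : 0 < min k₂ y / k₂ * F k₂ 0 := by positivity
    simp only [mul_zero, zero_add, add_zero] at h1
    linarith
  have hcont : Continuous fun c : ℝ => F (min k₂ y) (max c 0) := by
    have := hF.continuous_ext.comp (Continuous.prodMk_right (min k₂ y))
    simpa [Function.comp_def, max_eq_left hk.le] using this
  have hev : ∀ᶠ c in 𝓝[>] (0 : ℝ), 0 < F (min k₂ y) (max c 0) :=
    ((hcont.tendsto 0).mono_left nhdsWithin_le_nhds).eventually_const_lt (by simpa using h3)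
  obtain ⟨c, hc1, hc2⟩ := (hev.and self_mem_nhdsWithin).exists
  have hc0 : 0 < c := hc2
  rw [max_eq_left hc0.le] at hc1
  exact ⟨_, c, hk, min_le_right _ _, hc0, hc1.le⟩

/-- Consume the sustainable `c₁` forever and let the capital in excess of `k₁` decay at the rate `d`
of the slope bound: `F(k₁ + h, c₁) ≥ -d h`. The utility credited is the constant `u(c₁, k₁)`. -/
lemma feasibleValues_nonempty (hρ : 0 < ρ) (hW : W = W₁ ∨ W = W₂) (hu : UtilityAssumption u)
    (hF : TechnologyAssumption W F) {y : ℝ} (hy : 0 < y) :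
    (feasibleValues ρ W u F y).Nonempty := by
  obtain ⟨d, hd, hslope⟩ := hF.exists_slope_bound hW
  obtain ⟨k₁, c₁, hk₁, hk₁y, hc₁, hF₁⟩ := hF.exists_sustainable hy
  have hh : ∀ t : ℝ, 0 ≤ (y - k₁) * Real.exp (-d * t) := fun t =>
    mul_nonneg (by linarith) (Real.exp_pos _).le
  refine ⟨_, fun t => k₁ + (y - k₁) * Real.exp (-d * t), fun _ => c₁,
    fun t => -(d * ((y - k₁) * Real.exp (-d * t))), fun _ => (u c₁ k₁).toReal, ?_, rfl⟩
  refine ⟨fun T hT => Continuous.integrableOn_Icc (by fun_prop), fun t ht => ?_, fun t ht => ?_,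
    class_of_continuousOn hW continuousOn_const fun _ _ => hc₁.le,
    ⟨fun t => d * ((y - k₁) * Real.exp (-d * t)), class_of_continuousOn hW (by fun_prop)
      fun t _ => mul_nonneg hd.le (hh t), ae_of_all _ fun t => by simp⟩,
    ae_of_all _ fun t => ?_, ae_of_all _ fun t => ?_, ?_⟩
  · have hder : ∀ s ∈ uIcc 0 t, HasDerivAt (fun s => k₁ + (y - k₁) * Real.exp (-d * s))
        (-(d * ((y - k₁) * Real.exp (-d * s)))) s := by
      intro s _
      have := ((((hasDerivAt_id s).const_mul (-d)).exp).const_mul (y - k₁)).const_add k₁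
      simp only [id] at this
      exact this.congr_deriv (by ring)
    rw [intervalIntegral.integral_eq_sub_of_hasDerivAt hder
      (Continuous.intervalIntegrable (by fun_prop) _ _)]
    simp
  · linarith [hh t]
  · have := hslope k₁ ((y - k₁) * Real.exp (-d * t)) c₁ hk₁.le (hh t) hc₁.le
    linarith
  · rw [hu.coe_toReal hc₁ hk₁]
    exact hu.monotone _ _ _ _ hc₁.le le_rfl hk₁.le (by linarith [hh t])
  · refine Integrable.mul_const ?_ _
    exact (integrableOn_Ici_iff_integrableOn_Ioi).2 (integrableOn_exp_mul_Ioi (by linarith) 0)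

lemma UtilityAssumption.combo_le (hu : UtilityAssumption u) {k₁ c₁ k₂ c₂ a b w₁ w₂ : ℝ}
    (hk₁ : 0 ≤ k₁) (hc₁ : 0 ≤ c₁) (hk₂ : 0 ≤ k₂) (hc₂ : 0 ≤ c₂) (ha : 0 < a) (hb : 0 < b)
    (hab : a + b = 1) (h₁ : (w₁ : EReal) ≤ u c₁ k₁) (h₂ : (w₂ : EReal) ≤ u c₂ k₂) :
    ((a * w₁ + b * w₂ : ℝ) : EReal) ≤ u (a * c₁ + b * c₂) (a * k₁ + b * k₂) := by
  refine le_trans ?_ (hu.concave (c₁, k₁) (mem_quadrant hc₁ hk₁) (c₂, k₂) (mem_quadrant hc₂ hk₂)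
    a b ha hb hab)
  rw [EReal.coe_add, EReal.coe_mul, EReal.coe_mul]
  exact add_le_add (mul_le_mul_of_nonneg_left h₁ (EReal.coe_nonneg.2 ha.le))
    (mul_le_mul_of_nonneg_left h₂ (EReal.coe_nonneg.2 hb.le))

/-- Here the relaxation pays off: concavity turns the defining inequalities into the same
inequalities for the mixture, whereas an equation `k' = F(k, c)` would be lost. -/
lemma FeasibleOn.combo (hW : W = W₁ ∨ W = W₂) (hu : UtilityAssumption u)
    (hF : TechnologyAssumption W F) {x₁ x₂ a b : ℝ} {k₁ c₁ v₁ w₁ k₂ c₂ v₂ w₂ : ℝ → ℝ}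
    (h₁ : FeasibleOn (Ici 0) ρ W u F x₁ k₁ c₁ v₁ w₁)
    (h₂ : FeasibleOn (Ici 0) ρ W u F x₂ k₂ c₂ v₂ w₂) (ha : 0 < a) (hb : 0 < b) (hab : a + b = 1) :
    FeasibleOn (Ici 0) ρ W u F (a * x₁ + b * x₂) (fun t => a * k₁ t + b * k₂ t)
      (fun t => a * c₁ t + b * c₂ t) (fun t => a * v₁ t + b * v₂ t)
      (fun t => a * w₁ t + b * w₂ t) := by
  obtain ⟨g₁, hg₁, hvg₁⟩ := h₁.neg_v_le
  obtain ⟨g₂, hg₂, hvg₂⟩ := h₂.neg_v_le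
  have hc₁ := (class_subset hW h₁.mem_class).1
  have hc₂ := (class_subset hW h₂.mem_class).1
  refine ⟨fun T hT => ((h₁.integrable_v T hT).const_mul a).add ((h₂.integrable_v T hT).const_mul b),
    fun t ht => ?_, fun t ht => ?_,
    class_add hW (class_const_mul hW ha.le h₁.mem_class) (class_const_mul hW hb.le h₂.mem_class),
    ⟨fun t => a * g₁ t + b * g₂ t,
      class_add hW (class_const_mul hW ha.le hg₁) (class_const_mul hW hb.le hg₂), ?_⟩, ?_, ?_, ?_⟩
  · have i₁ := intervalIntegrable_of_Icc h₁.integrable_v le_rfl ht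
    have i₂ := intervalIntegrable_of_Icc h₂.integrable_v le_rfl ht
    rw [intervalIntegral.integral_add (i₁.const_mul a) (i₂.const_mul b),
      intervalIntegral.integral_const_mul, intervalIntegral.integral_const_mul,
      h₁.eq_integral t ht, h₂.eq_integral t ht]
    ring
  · have := mul_nonneg ha.le (h₁.nonneg_k t ht)
    have := mul_nonneg hb.le (h₂.nonneg_k t ht)
    linarith
  · filter_upwards [hvg₁, hvg₂] with t h1 h2
    have := mul_le_mul_of_nonneg_left h1 ha.le
    have := mul_le_mul_of_nonneg_left h2 hb.le
    linarith
  · filter_upwards [h₁.v_le, h₂.v_le, ae_restrict_mem measurableSet_Ici] with t h1 h2 ht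
    refine le_trans ?_ (hF.combo_le (h₁.nonneg_k t ht) (hc₁ t ht) (h₂.nonneg_k t ht) (hc₂ t ht)
      ha.le hb.le hab)
    gcongr
  · filter_upwards [h₁.w_le, h₂.w_le, ae_restrict_mem measurableSet_Ici] with t h1 h2 ht
    exact hu.combo_le (h₁.nonneg_k t ht) (hc₁ t ht) (h₂.nonneg_k t ht) (hc₂ t ht) ha hb hab h1 h2
  · refine ((h₁.integrable_w.const_mul a).add (h₂.integrable_w.const_mul b)).congr
      (ae_of_all _ fun t => ?_)
    simp only [Pi.add_apply]
    ring

lemma combo_mem_feasibleValues (hW : W = W₁ ∨ W = W₂) (hu : UtilityAssumption u)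
    (hF : TechnologyAssumption W F) {x₁ x₂ a b r₁ r₂ : ℝ} (h₁ : r₁ ∈ feasibleValues ρ W u F x₁)
    (h₂ : r₂ ∈ feasibleValues ρ W u F x₂) (ha : 0 < a) (hb : 0 < b) (hab : a + b = 1) :
    a * r₁ + b * r₂ ∈ feasibleValues ρ W u F (a * x₁ + b * x₂) := by
  obtain ⟨k₁, c₁, v₁, w₁, h₁, rfl⟩ := h₁
  obtain ⟨k₂, c₂, v₂, w₂, h₂, rfl⟩ := h₂
  refine ⟨_, _, _, _, h₁.combo hW hu hF h₂ ha hb hab, ?_⟩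
  rw [← integral_const_mul, ← integral_const_mul,
    ← integral_add (h₁.integrable_w.const_mul a) (h₂.integrable_w.const_mul b)]
  refine integral_congr_ae (ae_of_all _ fun t => ?_)
  simp only
  ring

/-! ### Concatenation, tails, and dynamic programming -/

lemma concat_integral_Ici {h : ℝ} (hh : 0 ≤ h) {f g : ℝ → ℝ} (hf : IntegrableOn f (Icc 0 h))
    (hg : IntegrableOn g (Ici 0)) :
    IntegrableOn (concat h f g) (Ici 0) ∧
      ∫ t in Ici (0 : ℝ), concat h f g t
        = (∫ t in Icc (0 : ℝ) h, f t) + ∫ t in Ici (0 : ℝ), g t := by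
  have hpre : (fun t : ℝ => t - h) ⁻¹' Ici 0 = Ici h := by
    ext t
    simp
  have h1 : IntegrableOn (concat h f g) (Ico 0 h) :=
    (hf.mono_set Ico_subset_Icc_self).congr_fun (fun t ht => (concat_of_lt ht.2).symm)
      measurableSet_Ico
  have h2 : IntegrableOn (fun t => g (t - h)) (Ici h) := by
    have := ((measurePreserving_sub_right volume h).integrableOn_comp_preimage
      (measurableEmbedding_subRight h) (f := g) (s := Ici 0)).2 hg
    rwa [hpre] at this
  have h3 : IntegrableOn (concat h f g) (Ici h) :=
    h2.congr_fun (fun t ht => (concat_of_ge ht).symm) measurableSet_Ici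
  have hunion : Ici (0 : ℝ) = Ico 0 h ∪ Ici h := (Ico_union_Ici_eq_Ici hh).symm
  have e1 : ∫ t in Ico (0 : ℝ) h, concat h f g t = ∫ t in Icc (0 : ℝ) h, f t := by
    rw [integral_Icc_eq_integral_Ico]
    exact setIntegral_congr_fun measurableSet_Ico fun t ht => concat_of_lt ht.2
  have e2 : ∫ t in Ici h, concat h f g t = ∫ t in Ici (0 : ℝ), g t := by
    rw [setIntegral_congr_fun measurableSet_Ici (fun t ht => concat_of_ge ht),
      ← (measurePreserving_sub_right volume h).setIntegral_preimage_emb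
        (measurableEmbedding_subRight h) g (Ici 0), hpre]
  refine ⟨by rw [hunion]; exact h1.union h3, ?_⟩
  rw [← e1, ← e2]
  nth_rewrite 1 [hunion]
  refine setIntegral_union ?_ measurableSet_Ici h1 h3
  exact disjoint_left.2 fun t ht ht' => absurd ht.2 (not_lt.2 ht')

lemma concat_intervalIntegral {h t : ℝ} (hh : 0 ≤ h) (ht : 0 ≤ t) {f g : ℝ → ℝ}
    (hf : ∀ T, 0 ≤ T → IntegrableOn f (Icc 0 T)) (hg : ∀ T, 0 ≤ T → IntegrableOn g (Icc 0 T)) :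
    ∫ s in (0 : ℝ)..t, concat h f g s
      = (∫ s in (0 : ℝ)..(min t h), f s) + ∫ s in (0 : ℝ)..(max (t - h) 0), g s := by
  have hlt : ∀ r, 0 ≤ r → r ≤ h →
      ∫ s in (0 : ℝ)..r, concat h f g s = ∫ s in (0 : ℝ)..r, f s := by
    intro r hr hrh
    refine intervalIntegral.integral_congr_ae ?_
    have h0 : ∀ᵐ s : ℝ, s ≠ h := by simp [ae_iff]
    filter_upwards [h0] with s hs hsm
    rw [uIoc_of_le hr] at hsm
    exact concat_of_lt (lt_of_le_of_ne (hsm.2.trans hrh) hs)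
  rcases le_total t h with hth | hth
  · rw [min_eq_left hth, max_eq_right (by linarith), hlt t ht hth]
    simp
  · rw [min_eq_right hth, max_eq_left (by linarith)]
    have hi : ∀ T, 0 ≤ T → IntegrableOn (concat h f g) (Icc 0 T) := fun T hT =>
      concat_integrableOn hh (hf h hh) (hg T hT)
    rw [← intervalIntegral.integral_add_adjacent_intervals
      (intervalIntegrable_of_Icc hi le_rfl hh) (intervalIntegrable_of_Icc hi hh ht),
      hlt h hh le_rfl]
    congr 1
    rw [← sub_self h, ← intervalIntegral.integral_comp_sub_right (fun s => g s) h]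
    refine intervalIntegral.integral_congr fun s hs => ?_
    rw [uIcc_of_le hth] at hs
    exact concat_of_ge hs.1

/-- Follow a relaxed trajectory until time `h`, then another one. -/
lemma FeasibleOn.concat (hW : W = W₁ ∨ W = W₂) {h : ℝ} (hh : 0 ≤ h)
    {k₁ c₁ v₁ w₁ k₂ c₂ v₂ w₂ : ℝ → ℝ}
    (h₁ : FeasibleOn (Icc 0 h) ρ W u F x k₁ c₁ v₁ w₁)
    (h₂ : FeasibleOn (Ici 0) ρ W u F (k₁ h) k₂ c₂ v₂ w₂) :
    ((∫ t in Icc (0 : ℝ) h, Real.exp (-ρ * t) * w₁ t)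
      + Real.exp (-ρ * h) * ∫ t in Ici (0 : ℝ), Real.exp (-ρ * t) * w₂ t)
      ∈ feasibleValues ρ W u F x := by
  obtain ⟨g₁, hg₁, hvg₁⟩ := h₁.neg_v_le
  obtain ⟨g₂, hg₂, hvg₂⟩ := h₂.neg_v_le
  have hw : (fun t => Real.exp (-ρ * t) * RCK.concat h w₁ w₂ t)
      = RCK.concat h (fun t => Real.exp (-ρ * t) * w₁ t)
          (fun t => Real.exp (-ρ * h) * (Real.exp (-ρ * t) * w₂ t)) := by
    ext t
    rcases lt_or_ge t h with ht | ht
    · simp only [concat_of_lt ht]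
    · simp only [concat_of_ge ht]
      rw [← mul_assoc, ← Real.exp_add]
      ring_nf
  obtain ⟨hi, he⟩ := concat_integral_Ici hh h₁.integrable_w
    (h₂.integrable_w.const_mul (Real.exp (-ρ * h)))
  refine ⟨RCK.concat h k₁ k₂, RCK.concat h c₁ c₂, RCK.concat h v₁ v₂, RCK.concat h w₁ w₂,
    ⟨fun T hT => concat_integrableOn hh (h₁.integrable_v h hh) (h₂.integrable_v T hT),
    fun t ht => ?_, fun t ht => ?_, class_concat hW hh h₁.mem_class h₂.mem_class,
    ⟨RCK.concat h g₁ g₂, class_concat hW hh hg₁ hg₂, ?_⟩, ?_, ?_, ?_⟩, ?_⟩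
  · rw [concat_intervalIntegral hh ht h₁.integrable_v h₂.integrable_v]
    rcases lt_or_ge t h with hth | hth
    · rw [concat_of_lt hth, min_eq_left hth.le, max_eq_right (by linarith),
        h₁.eq_integral t ⟨ht, hth.le⟩]
      simp
    · rw [concat_of_ge hth, min_eq_right hth, max_eq_left (by linarith),
        h₂.eq_integral (t - h) (mem_Ici.2 (by linarith)), h₁.eq_integral h ⟨hh, le_rfl⟩]
      ring
  · rcases lt_or_ge t h with hth | hth
    · rw [concat_of_lt hth]; exact h₁.nonneg_k t ⟨ht, hth.le⟩
    · rw [concat_of_ge hth]; exact h₂.nonneg_k _ (mem_Ici.2 (by linarith))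
  · refine ae_restrict_Ici_split (h := h) ?_ ?_
    -- At `t = h` the concatenation already follows the second path; that point is null.
    · have h0 : ∀ᵐ t ∂(volume.restrict (Icc 0 h)), t ≠ h := ae_restrict_of_ae (by simp [ae_iff])
      filter_upwards [ae_restrict_of_ae_restrict_of_subset Icc_subset_Ici_self hvg₁, h0,
        ae_restrict_mem measurableSet_Icc] with t ht hne hm
      have hlt := lt_of_le_of_ne hm.2 hne
      rwa [concat_of_lt hlt, concat_of_lt hlt]
    · filter_upwards [ae_restrict_Ici_shift (h := h) hvg₂, ae_restrict_mem measurableSet_Ici]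
        with t ht hm
      rwa [concat_of_ge hm, concat_of_ge hm]
  · refine ae_restrict_Ici_split (h := h) ?_ ?_
    · have h0 : ∀ᵐ t ∂(volume.restrict (Icc 0 h)), t ≠ h := ae_restrict_of_ae (by simp [ae_iff])
      filter_upwards [h₁.v_le, h0, ae_restrict_mem measurableSet_Icc] with t ht hne hm
      have hlt := lt_of_le_of_ne hm.2 hne
      rwa [concat_of_lt hlt, concat_of_lt hlt, concat_of_lt hlt]
    · filter_upwards [ae_restrict_Ici_shift (h := h) h₂.v_le, ae_restrict_mem measurableSet_Ici]
        with t ht hm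
      rwa [concat_of_ge hm, concat_of_ge hm, concat_of_ge hm]
  · refine ae_restrict_Ici_split (h := h) ?_ ?_
    · have h0 : ∀ᵐ t ∂(volume.restrict (Icc 0 h)), t ≠ h := ae_restrict_of_ae (by simp [ae_iff])
      filter_upwards [h₁.w_le, h0, ae_restrict_mem measurableSet_Icc] with t ht hne hm
      have hlt := lt_of_le_of_ne hm.2 hne
      rwa [concat_of_lt hlt, concat_of_lt hlt, concat_of_lt hlt]
    · filter_upwards [ae_restrict_Ici_shift (h := h) h₂.w_le, ae_restrict_mem measurableSet_Ici]
        with t ht hm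
      rwa [concat_of_ge hm, concat_of_ge hm, concat_of_ge hm]
  · rw [hw]; exact hi
  · rw [hw, he, integral_const_mul]

lemma FeasibleOn.mono {S T : Set ℝ} (h : FeasibleOn S ρ W u F x k c v w) (hTS : T ⊆ S) :
    FeasibleOn T ρ W u F x k c v w :=
  ⟨h.integrable_v, fun t ht => h.eq_integral t (hTS ht), fun t ht => h.nonneg_k t (hTS ht),
    h.mem_class, h.neg_v_le, ae_restrict_of_ae_restrict_of_subset hTS h.v_le,
    ae_restrict_of_ae_restrict_of_subset hTS h.w_le, h.integrable_w.mono_set hTS⟩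

/-- The remainder of a relaxed trajectory after time `h`. -/
lemma FeasibleOn.tail (hW : W = W₁ ∨ W = W₂) {h : ℝ} (hh : 0 ≤ h)
    (hf : FeasibleOn (Ici 0) ρ W u F x k c v w) :
    Real.exp (ρ * h) * ((∫ t in Ici (0 : ℝ), Real.exp (-ρ * t) * w t)
      - ∫ t in (0 : ℝ)..h, Real.exp (-ρ * t) * w t) ∈ feasibleValues ρ W u F (k h) := by
  obtain ⟨g, hg, hvg⟩ := hf.neg_v_le
  have hpre : (fun t : ℝ => h + t) ⁻¹' Ici h = Ici 0 := by
    ext t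
    simp
  have hwi : IntegrableOn (fun t => Real.exp (-ρ * t) * w t) (Ici h) :=
    hf.integrable_w.mono_set (Ici_subset_Ici.2 hh)
  have hweq : (fun t => Real.exp (-ρ * t) * w (h + t))
      = fun t => Real.exp (ρ * h) * (Real.exp (-ρ * (h + t)) * w (h + t)) := by
    ext t
    rw [← mul_assoc, ← Real.exp_add]
    ring_nf
  have hwi' : IntegrableOn (fun t => Real.exp (-ρ * (h + t)) * w (h + t)) (Ici 0) := by
    have := ((measurePreserving_add_left volume h).integrableOn_comp_preimage
      (measurableEmbedding_addLeft h) (f := fun t => Real.exp (-ρ * t) * w t) (s := Ici h)).2 hwi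
    rwa [hpre] at this
  refine ⟨fun t => k (h + t), fun t => c (h + t), fun t => v (h + t), fun t => w (h + t),
    ⟨fun T hT => ?_, fun t ht => ?_, fun t ht => hf.nonneg_k _ (mem_Ici.2 (add_nonneg hh ht)),
    class_shift hW hh hf.mem_class, ⟨fun t => g (h + t), class_shift hW hh hg,
      ae_restrict_Ici_shift_add hh hvg⟩, ae_restrict_Ici_shift_add hh hf.v_le,
      ae_restrict_Ici_shift_add hh hf.w_le, ?_⟩, ?_⟩
  · have h1 : IntegrableOn v (Icc h (h + T)) :=
      (hf.integrable_v (h + T) (by linarith)).mono_set (Icc_subset_Icc_left hh)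
    have h2 := ((measurePreserving_add_left volume h).integrableOn_comp_preimage
      (measurableEmbedding_addLeft h) (f := v) (s := Icc h (h + T))).2 h1
    simpa [Function.comp_def] using h2
  · have ht' : 0 ≤ t := ht
    rw [intervalIntegral.integral_comp_add_left (fun s => v s) h, add_zero,
      hf.eq_integral _ (mem_Ici.2 (add_nonneg hh ht)), hf.eq_integral h hh,
      ← intervalIntegral.integral_add_adjacent_intervals
        (intervalIntegrable_of_Icc hf.integrable_v le_rfl hh)
        (intervalIntegrable_of_Icc hf.integrable_v hh (add_nonneg hh ht))]
    ring
  · rw [hweq]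
    exact hwi'.const_mul _
  · rw [hweq, integral_const_mul]
    congr 1
    have e1 := (measurePreserving_add_left volume h).setIntegral_preimage_emb
      (measurableEmbedding_addLeft h) (fun t => Real.exp (-ρ * t) * w t) (Ici h)
    rw [hpre] at e1
    rw [e1, intervalIntegral.integral_of_le hh, sub_eq_iff_eq_add, ← integral_Ico_eq_integral_Ioc,
      ← setIntegral_union _ measurableSet_Ico hwi
        (hf.integrable_w.mono_set Ico_subset_Ici_self), union_comm, Ico_union_Ici_eq_Ici hh]
    exact disjoint_left.2 fun t ht ht' => absurd ht'.2 (not_lt.2 ht)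

/-- A short straight path of capital, along which consumption is at least `c`. -/
lemma feasibleOn_linear (hW : W = W₁ ∨ W = W₂) {h x c r w : ℝ} (hc : 0 ≤ c)
    (hx : ∀ t ∈ Icc 0 h, 0 ≤ x + r * t) (hr : ∀ t ∈ Icc 0 h, r ≤ F (x + r * t) c)
    (hw : ∀ t ∈ Icc 0 h, (w : EReal) ≤ u c (x + r * t)) :
    FeasibleOn (Icc 0 h) ρ W u F x (fun t => x + r * t) (fun _ => c) (fun _ => r) (fun _ => w) := by
  refine ⟨fun T _ => by simp, fun t _ => by simp [mul_comm], hx,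
    class_of_continuousOn hW continuousOn_const fun _ _ => hc,
    ⟨fun _ => |r|, class_of_continuousOn hW continuousOn_const fun _ _ => abs_nonneg r,
      ae_of_all _ fun _ => neg_le_abs r⟩, ?_, ?_, Continuous.integrableOn_Icc (by fun_prop)⟩
  · filter_upwards [ae_restrict_mem measurableSet_Icc] with t ht using hr t ht
  · filter_upwards [ae_restrict_mem measurableSet_Icc] with t ht using hw t ht

/-- The value function as a real-valued function on the positive half line. -/
noncomputable def realValue (ρ : ℝ) (W : Set (ℝ → ℝ)) (u : ℝ → ℝ → EReal) (F : ℝ → ℝ → ℝ)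
    (x : ℝ) : ℝ := (valueFunction ρ W u F x).toReal

lemma valueFunction_eq (hρ : 0 < ρ) (hW : W = W₁ ∨ W = W₂) (hu : UtilityAssumption u)
    (hF : TechnologyAssumption W F) (hG : GrowthAssumption ρ u F) (hx : 0 < x) :
    valueFunction ρ W u F x = realValue ρ W u F x ∧
      IsLUB (feasibleValues ρ W u F x) (realValue ρ W u F x) := by
  obtain ⟨V, hV, hlub⟩ := isLUB_valueFunction hρ hW hu hF hG
    (feasibleValues_nonempty hρ hW hu hF hx)
  rw [realValue, hV]
  exact ⟨rfl, hlub⟩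

/-- Concavity of `V`, from mixing relaxed trajectories. Suprema need not be attained, so they are
taken one after the other, first over `r₁`, then over `r₂`. -/
lemma realValue_combo_le (hρ : 0 < ρ) (hW : W = W₁ ∨ W = W₂) (hu : UtilityAssumption u)
    (hF : TechnologyAssumption W F) (hG : GrowthAssumption ρ u F) {x₁ x₂ a b : ℝ} (hx₁ : 0 < x₁)
    (hx₂ : 0 < x₂) (ha : 0 < a) (hb : 0 < b) (hab : a + b = 1) :
    a * realValue ρ W u F x₁ + b * realValue ρ W u F x₂ ≤ realValue ρ W u F (a * x₁ + b * x₂) := by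
  have l₁ := (valueFunction_eq hρ hW hu hF hG hx₁).2
  have l₂ := (valueFunction_eq hρ hW hu hF hG hx₂).2
  have l := (valueFunction_eq hρ hW hu hF hG (by positivity : 0 < a * x₁ + b * x₂)).2
  set V := realValue ρ W u F (a * x₁ + b * x₂)
  have h1 : ∀ r₂ ∈ feasibleValues ρ W u F x₂, a * realValue ρ W u F x₁ + b * r₂ ≤ V := by
    intro r₂ hr₂
    have : realValue ρ W u F x₁ ≤ (V - b * r₂) / a := l₁.2 fun r₁ hr₁ => by
      rw [le_div_iff₀ ha]
      linarith [l.1 (combo_mem_feasibleValues hW hu hF hr₁ hr₂ ha hb hab)]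
    rw [le_div_iff₀ ha] at this
    linarith
  have h2 : realValue ρ W u F x₂ ≤ (V - a * realValue ρ W u F x₁) / b := l₂.2 fun r₂ hr₂ => by
    rw [le_div_iff₀ hb]
    linarith [h1 r₂ hr₂]
  rw [le_div_iff₀ hb] at h2
  linarith

/-- One half of the dynamic programming principle. -/
lemma FeasibleOn.add_realValue_le (hρ : 0 < ρ) (hW : W = W₁ ∨ W = W₂) (hu : UtilityAssumption u)
    (hF : TechnologyAssumption W F) (hG : GrowthAssumption ρ u F) (hx : 0 < x) {h : ℝ} (hh : 0 ≤ h)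
    (hf : FeasibleOn (Icc 0 h) ρ W u F x k c v w) (hk : 0 < k h) :
    (∫ t in Icc (0 : ℝ) h, Real.exp (-ρ * t) * w t) + Real.exp (-ρ * h) * realValue ρ W u F (k h)
      ≤ realValue ρ W u F x := by
  have l := (valueFunction_eq hρ hW hu hF hG hx).2
  have l' := (valueFunction_eq hρ hW hu hF hG hk).2
  set I := ∫ t in Icc (0 : ℝ) h, Real.exp (-ρ * t) * w t
  have he := Real.exp_pos (-ρ * h)
  have : realValue ρ W u F (k h) ≤ (realValue ρ W u F x - I) / Real.exp (-ρ * h) := by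
    refine l'.2 ?_
    rintro r ⟨k₂, c₂, v₂, w₂, h₂, rfl⟩
    rw [le_div_iff₀ he]
    linarith [l.1 (hf.concat hW hh h₂)]
  rw [le_div_iff₀ he] at this
  linarith

/-! ### The Hamilton–Jacobi–Bellman inequality and the price of capital -/

lemma deriv_nonpos_of_eventually_le {φ : ℝ → ℝ} {d : ℝ} (hd : HasDerivAt φ d 0)
    (hle : ∀ᶠ h in 𝓝[>] (0 : ℝ), φ h ≤ φ 0) : d ≤ 0 := by
  have h1 := hd.tendsto_slope.mono_left (nhdsWithin_mono 0 (s := Ioi 0) fun h (hh : 0 < h) => hh.ne')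
  refine le_of_tendsto h1 ?_
  filter_upwards [hle, self_mem_nhdsWithin] with h hh h0
  rw [slope_def_field]
  exact div_nonpos_of_nonpos_of_nonneg (by linarith) (by linarith [mem_Ioi.1 h0])

lemma UtilityAssumption.differentiableOn_c (hu : UtilityAssumption u) {k : ℝ} (hk : 0 < k) :
    DifferentiableOn ℝ (fun c => (u c k).toReal) (Ioi 0) := by
  have h1 := (hu.contDiffOn.differentiableOn (by norm_num)).comp
    (f := fun c : ℝ => (c, k)) (s := Ioi 0) (by fun_prop) fun c hc => ⟨hc, hk⟩
  exact h1

/-- The value function is a supersolution of the Hamilton-Jacobi-Bellman equation. -/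
lemma realValue_sub_le (hρ : 0 < ρ) (hW : W = W₁ ∨ W = W₂) (hu : UtilityAssumption u)
    (hF : TechnologyAssumption W F) (hG : GrowthAssumption ρ u F) (hx : 0 < x) {c s : ℝ}
    (hc : 0 < c) (hs : 0 < s) (hxs : 0 < x + s * F x c) :
    realValue ρ W u F (x + s * F x c) - realValue ρ W u F x
      ≤ s * (ρ * realValue ρ W u F x - (u c x).toReal) := by
  set V := realValue ρ W u F with hV
  set r := F x c with hr
  -- Giving up `ε` of consumption makes `r < F(x, c - ε)` strict, so it persists near `x` and the
  -- straight path of speed `r` is feasible for a short time.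
  have key : ∀ ε, 0 < ε → ε < c → ε < x →
      (u (c - ε) (x - ε)).toReal + (V (x + s * r) - V x) / s - ρ * V x ≤ 0 := by
    intro ε hε hεc hεx
    set w := (u (c - ε) (x - ε)).toReal with hw
    -- The dynamic programming lower bound, with `V(x + r h)` replaced by the chord of `V` from `x`
    -- to `x + s r`. By concavity `φ h ≤ V x = φ 0`, and `φ` is differentiable although `V` need not
    -- be.
    set φ : ℝ → ℝ := fun h => (∫ t in (0 : ℝ)..h, Real.exp (-ρ * t) * w)
      + Real.exp (-ρ * h) * ((1 - h / s) * V x + h / s * V (x + s * r)) with hφ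
    have hder : HasDerivAt φ (w + (V (x + s * r) - V x) / s - ρ * V x) 0 := by
      have h1 : HasDerivAt (fun h => ∫ t in (0 : ℝ)..h, Real.exp (-ρ * t) * w)
          (Real.exp (-ρ * 0) * w) 0 :=
        (Continuous.integral_hasStrictDerivAt (by fun_prop) 0 0).hasDerivAt
      have h2 : HasDerivAt (fun h : ℝ => Real.exp (-ρ * h)) (-ρ) 0 := by
        have := ((hasDerivAt_id (0 : ℝ)).const_mul (-ρ)).exp
        simpa using this
      have h3 : HasDerivAt (fun h : ℝ => (1 - h / s) * V x + h / s * V (x + s * r))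
          ((V (x + s * r) - V x) / s) 0 := by
        have h4 : HasDerivAt (fun h : ℝ => h / s) (1 / s) 0 := (hasDerivAt_id (0 : ℝ)).div_const s
        have h5 := ((h4.const_sub 1).mul_const (V x)).add (h4.mul_const (V (x + s * r)))
        exact h5.congr_deriv (by ring)
      refine (h1.add (h2.mul h3)).congr_deriv ?_
      simp
      ring
    refine deriv_nonpos_of_eventually_le hder ?_
    have hcont : Continuous fun t : ℝ => F (max (x + r * t) 0) (max (c - ε) 0) :=
      hF.continuous_ext.comp (f := fun t : ℝ => (x + r * t, c - ε)) (by fun_prop)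
    have hlin : Continuous fun t : ℝ => x + r * t := by fun_prop
    have e1 : ∀ᶠ t in 𝓝 (0 : ℝ), r < F (max (x + r * t) 0) (max (c - ε) 0) := by
      refine (hcont.tendsto 0).eventually_const_lt ?_
      rw [mul_zero, add_zero, max_eq_left hx.le, max_eq_left (by linarith)]
      exact hF.decreasing_c x (c - ε) c hx.le (by linarith) (by linarith)
    have e2 : ∀ᶠ t in 𝓝 (0 : ℝ), x - ε < x + r * t :=
      (hlin.tendsto 0).eventually_const_lt (by simpa using hε)
    obtain ⟨δ, hδ, hball⟩ := Metric.eventually_nhds_iff.1 (e1.and e2)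
    filter_upwards [Ioo_mem_nhdsGT (lt_min hδ hs)] with h hh
    have hhs : h < s := hh.2.trans_le (min_le_right _ _)
    have hall : ∀ t ∈ Icc 0 h, r < F (max (x + r * t) 0) (max (c - ε) 0) ∧ x - ε < x + r * t := by
      intro t ht
      refine hball ?_
      rw [Real.dist_eq, sub_zero, abs_of_nonneg ht.1]
      exact ht.2.trans_lt (hh.2.trans_le (min_le_left _ _))
    have hpos : ∀ t ∈ Icc 0 h, 0 < x + r * t := fun t ht => by linarith [(hall t ht).2]
    have hfeas : FeasibleOn (Icc 0 h) ρ W u F x (fun t => x + r * t) (fun _ => c - ε) (fun _ => r)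
        (fun _ => w) := by
      refine feasibleOn_linear hW (by linarith) (fun t ht => (hpos t ht).le) (fun t ht => ?_)
        fun t ht => ?_
      · have := (hall t ht).1
        rw [max_eq_left (hpos t ht).le, max_eq_left (by linarith)] at this
        exact this.le
      · rw [hw, hu.coe_toReal (by linarith) (by linarith)]
        exact hu.monotone _ _ _ _ (by linarith) le_rfl (by linarith) (hall t ht).2.le
    have hdpp := hfeas.add_realValue_le hρ hW hu hF hG hx hh.1.le (hpos h ⟨hh.1.le, le_rfl⟩)
    have hconc := realValue_combo_le hρ hW hu hF hG hx hxs (a := 1 - h / s) (b := h / s)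
      (by rw [sub_pos, div_lt_one hs]; exact hhs) (div_pos hh.1 hs) (by ring)
    have hpt : (1 - h / s) * x + h / s * (x + s * r) = x + r * h := by field_simp; ring
    rw [hpt] at hconc
    have hφ0 : φ 0 = V x := by simp [hφ]
    rw [hφ0, hφ]
    simp only
    rw [intervalIntegral.integral_of_le hh.1.le, ← integral_Icc_eq_integral_Ioc]
    refine le_trans ?_ hdpp
    gcongr
  have hcont : Continuous fun ε : ℝ => u (max (c - ε) 0) (max (x - ε) 0) :=
    hu.continuous_ext.comp (f := fun ε : ℝ => (c - ε, x - ε)) (by fun_prop)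
  have hlim : Tendsto (fun ε : ℝ => (u (max (c - ε) 0) (max (x - ε) 0)).toReal) (𝓝[>] 0)
      (𝓝 (u c x).toReal) := by
    have hfin : u c x ≠ ⊤ ∧ u c x ≠ ⊥ := by
      rw [← hu.coe_toReal hc hx]
      exact ⟨EReal.coe_ne_top _, EReal.coe_ne_bot _⟩
    have h1 : Tendsto (fun ε : ℝ => u (max (c - ε) 0) (max (x - ε) 0)) (𝓝[>] 0) (𝓝 (u c x)) := by
      have := (hcont.tendsto 0).mono_left (nhdsWithin_le_nhds (s := Ioi 0))
      simpa [hc.le, hx.le] using this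
    exact (EReal.tendsto_toReal hfin.1 hfin.2).comp h1
  have hfinal : (u c x).toReal + (V (x + s * r) - V x) / s - ρ * V x ≤ 0 := by
    refine le_of_tendsto ((hlim.add_const _).sub_const _) ?_
    filter_upwards [Ioo_mem_nhdsGT (lt_min hc hx)] with ε hε
    have h1 : ε < c := hε.2.trans_le (min_le_left _ _)
    have h2 : ε < x := hε.2.trans_le (min_le_right _ _)
    rw [max_eq_left (by linarith), max_eq_left (by linarith)]
    exact key ε hε.1 h1 h2
  have h1 : (V (x + s * r) - V x) / s ≤ ρ * V x - (u c x).toReal := by linarith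
  rw [div_le_iff₀ hs] at h1
  linarith

/-- Helly's theorem for half lines: a system of inequalities `r ≤ p w` in one unknown `p` is
solvable if any two of them are. -/
lemma exists_multiplier {S : Set (ℝ × ℝ)} (hpos : ∃ z ∈ S, 0 < z.1) (hneg : ∃ z ∈ S, z.1 < 0)
    (hpair : ∀ z ∈ S, ∀ z' ∈ S, z.1 < 0 → 0 < z'.1 → z'.2 * (-z.1) + z.2 * z'.1 ≤ 0)
    (hzero : ∀ z ∈ S, z.1 = 0 → z.2 ≤ 0) : ∃ p : ℝ, ∀ z ∈ S, z.2 ≤ p * z.1 := by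
  have hub : ∀ z ∈ S, z.1 < 0 → ∀ q ∈ {q | ∃ z ∈ S, 0 < z.1 ∧ q = z.2 / z.1}, q ≤ z.2 / z.1 := by
    rintro z hz hz0 q ⟨z', hz', hz'0, rfl⟩
    rw [div_le_iff₀ hz'0, div_mul_eq_mul_div, le_div_iff_of_neg hz0]
    linarith [hpair z hz z' hz' hz0 hz'0]
  obtain ⟨z₁, hz₁, hz₁0⟩ := hneg
  obtain ⟨z₂, hz₂, hz₂0⟩ := hpos
  obtain ⟨p, hlub⟩ : ∃ p, IsLUB {q | ∃ z ∈ S, 0 < z.1 ∧ q = z.2 / z.1} p :=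
    ⟨_, isLUB_csSup ⟨_, z₂, hz₂, hz₂0, rfl⟩ ⟨_, hub z₁ hz₁ hz₁0⟩⟩
  refine ⟨p, fun z hz => ?_⟩
  rcases lt_trichotomy z.1 0 with h | h | h
  · exact (le_div_iff_of_neg h).1 (hlub.2 (hub z hz h))
  · rw [h, mul_zero]
    exact hzero z hz h
  · exact (div_le_iff₀ h).1 (hlub.1 ⟨z, hz, h, rfl⟩)

/-- A supergradient of the value function that serves as a price of capital. -/
lemma exists_price (hρ : 0 < ρ) (hW : W = W₁ ∨ W = W₂) (hu : UtilityAssumption u)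
    (hF : TechnologyAssumption W F) (hG : GrowthAssumption ρ u F) (hx : 0 < x) :
    ∃ p : ℝ, (∀ y, 0 < y → realValue ρ W u F y ≤ realValue ρ W u F x + p * (y - x)) ∧
      ∀ c, 0 < c → p * F x c + (u c x).toReal ≤ ρ * realValue ρ W u F x := by
  set V := realValue ρ W u F with hV
  have hjb : ∀ c, 0 < c → ∀ s, 0 < s → 0 < x + s * F x c →
      V (x + s * F x c) - V x ≤ s * (ρ * V x - (u c x).toReal) := fun c hc s hs h =>
    realValue_sub_le hρ hW hu hF hG hx hc hs h
  -- Raise consumption until growth stops: standing still at `x` already yields at least `u(c, x)`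
  -- forever.
  have hstat : ∀ c, 0 < c → 0 ≤ F x c → (u c x).toReal ≤ ρ * V x := by
    intro c hc hFc
    obtain ⟨h1, h2⟩ := hF.apply_techInv hG hx.le hc.le hFc
    have hc' : 0 < techInv F x 0 := hc.trans_le h2
    have h3 := hjb _ hc' 1 one_pos (by rw [h1]; linarith)
    rw [h1] at h3
    have h4 : (u c x).toReal ≤ (u (techInv F x 0) x).toReal := by
      rw [← EReal.coe_le_coe_iff, hu.coe_toReal hc hx, hu.coe_toReal hc' hx]
      exact hu.monotone _ _ _ _ hc.le h2 hx.le le_rfl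
    simp only [mul_zero, add_zero, one_mul, sub_self] at h3
    linarith
  -- Apply `hjb` with `s` chosen so that the displacement ends at `y`; the factors are multiplied
  -- out to treat both signs at once.
  have hcross : ∀ y, 0 < y → ∀ c, 0 < c → 0 < (y - x) * F x c →
      (V y - V x) * F x c * (y - x) ≤ (y - x) * (y - x) * (ρ * V x - (u c x).toReal) := by
    intro y hy c hc hyc
    have hF0 : F x c ≠ 0 := fun h => by simp [h] at hyc
    have hyx : y - x ≠ 0 := fun h => by simp [h] at hyc
    set s := (y - x) / F x c with hs
    have hsF : s * F x c = y - x := div_mul_cancel₀ _ hF0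
    have hs0 : 0 < s := by
      have : s = (y - x) * F x c / (F x c) ^ 2 := by rw [hs]; field_simp
      rw [this]
      positivity
    have h1 := hjb c hc s hs0 (by rw [hsF]; linarith)
    rw [hsF, add_sub_cancel] at h1
    calc (V y - V x) * F x c * (y - x) = (V y - V x) * ((y - x) * F x c) := by ring
      _ ≤ s * (ρ * V x - (u c x).toReal) * ((y - x) * F x c) := by gcongr
      _ = (s * F x c) * (y - x) * (ρ * V x - (u c x).toReal) := by ring
      _ = _ := by rw [hsF]
  -- Both requirements on `p` are half lines `z.2 ≤ p z.1`: the first family says that `p` is a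
  -- supergradient, the second is the Hamiltonian inequality.
  suffices hmain : ∃ p : ℝ, ∀ z ∈ {z : ℝ × ℝ | ∃ y, 0 < y ∧ z = (y - x, V y - V x)} ∪
      {z | ∃ c, 0 < c ∧ z = (-F x c, (u c x).toReal - ρ * V x)}, z.2 ≤ p * z.1 by
    obtain ⟨p, hp⟩ := hmain
    refine ⟨p, fun y hy => ?_, fun c hc => ?_⟩
    · have := hp _ (Or.inl ⟨y, hy, rfl⟩)
      simp only at this
      linarith
    · have := hp _ (Or.inr ⟨c, hc, rfl⟩)
      simp only at this
      linarith
  refine exists_multiplier ⟨_, Or.inl ⟨x + 1, by linarith, rfl⟩, by simp⟩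
    ⟨_, Or.inl ⟨x / 2, by linarith, rfl⟩, by simp only; linarith⟩ ?_ ?_
  · rintro z (⟨y₁, hy₁, rfl⟩ | ⟨c₁, hc₁, rfl⟩) z' (⟨y₂, hy₂, rfl⟩ | ⟨c₂, hc₂, rfl⟩) hz hz'
    -- Two supergradient conditions on opposite sides of `x`: this is concavity of `V`.
    · simp only at hz hz' ⊢
      have hd : 0 < y₂ - y₁ := by linarith
      have h1 := realValue_combo_le hρ hW hu hF hG hy₁ hy₂ (a := (y₂ - x) / (y₂ - y₁))
        (b := (x - y₁) / (y₂ - y₁)) (by positivity) (div_pos (by linarith) hd)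
        (by field_simp; ring)
      have h2 : (y₂ - x) / (y₂ - y₁) * y₁ + (x - y₁) / (y₂ - y₁) * y₂ = x := by
        field_simp
        ring
      rw [h2, div_mul_eq_mul_div, div_mul_eq_mul_div, ← add_div, div_le_iff₀ hd] at h1
      linarith
    · simp only at hz hz' ⊢
      have h1 := hcross y₁ hy₁ c₂ hc₂ (mul_pos_of_neg_of_neg hz (by linarith))
      by_contra hcon
      have h2 := mul_pos (not_le.1 hcon) (neg_pos.2 hz)
      linarith
    · simp only at hz hz' ⊢
      have h1 := hcross y₂ hy₂ c₁ hc₁ (mul_pos hz' (by linarith))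
      by_contra hcon
      have h2 := mul_pos (not_le.1 hcon) hz'
      linarith
    -- Two consumptions with growth of opposite signs: the weights cancel the mixed growth, so by
    -- concavity the mixed consumption satisfies `hstat`.
    · simp only at hz hz' ⊢
      have hd : 0 < F x c₁ - F x c₂ := by linarith
      have ha : 0 < -F x c₂ / (F x c₁ - F x c₂) := div_pos hz' hd
      have hb : 0 < F x c₁ / (F x c₁ - F x c₂) := div_pos (by linarith) hd
      have hab : -F x c₂ / (F x c₁ - F x c₂) + F x c₁ / (F x c₁ - F x c₂) = 1 := by
        field_simp
        ring
      set a := -F x c₂ / (F x c₁ - F x c₂) with hadef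
      set b := F x c₁ / (F x c₁ - F x c₂) with hbdef
      have hxx : a * x + b * x = x := by rw [← add_mul, hab, one_mul]
      have hcc : 0 < a * c₁ + b * c₂ := by positivity
      have h1 := hF.combo_le hx.le hc₁.le hx.le hc₂.le ha.le hb.le hab
      have h2 := hu.combo_le hx.le hc₁.le hx.le hc₂.le ha hb hab
        (hu.coe_toReal hc₁ hx).le (hu.coe_toReal hc₂ hx).le
      rw [hxx] at h1 h2
      have h3 : a * F x c₁ + b * F x c₂ = 0 := by
        rw [hadef, hbdef]
        field_simp
        ring
      have h4 := hstat _ hcc (by linarith)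
      rw [← hu.coe_toReal hcc hx, EReal.coe_le_coe_iff] at h2
      have h5 : a * (u c₁ x).toReal + b * (u c₂ x).toReal ≤ ρ * V x := h2.trans h4
      have h6 : (a * (u c₁ x).toReal + b * (u c₂ x).toReal) * (F x c₁ - F x c₂)
          = -F x c₂ * (u c₁ x).toReal + F x c₁ * (u c₂ x).toReal := by
        rw [hadef, hbdef]
        field_simp
      have h7 := mul_le_mul_of_nonneg_right h5 hd.le
      rw [h6] at h7
      linarith
  · rintro z (⟨y, hy, rfl⟩ | ⟨c, hc, rfl⟩) hz
    · simp only at hz ⊢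
      rw [sub_eq_zero.1 hz]
      simp
    · simp only at hz ⊢
      linarith [hstat c hc (by linarith)]

/-! ### Maximizers of the Hamiltonian -/

lemma strictConcaveOn_utility (hu : UtilityAssumption u) (hI : InadaAssumption u) (hx : 0 < x) :
    StrictConcaveOn ℝ (Ioi 0) fun c => (u c x).toReal := by
  refine StrictAntiOn.strictConcaveOn_of_deriv (convex_Ioi 0)
    (hu.differentiableOn_c hx).continuousOn ?_
  rw [interior_Ioi]
  exact hI.derivC_decreasing x hx

/-- Finite linear support of `u(·, x)` at `0` contradicts infinite marginal utility there. -/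
lemma not_supported_at_zero (hu : UtilityAssumption u) (hI : InadaAssumption u) (hx : 0 < x)
    (h0 : u 0 x ≠ ⊥) {L : ℝ} :
    ¬ ∀ c, 0 < c → c < 1 → (u c x).toReal - (u 0 x).toReal ≤ L * c := by
  intro h
  obtain ⟨δ, hδ, hder⟩ := (mem_nhdsGT_iff_exists_Ioo_subset).1
    ((hI.derivC_zero x hx).eventually_gt_atTop L)
  have hδ0 : 0 < δ := hδ
  set e := min δ 1 with he
  have he0 : 0 < e := lt_min hδ0 one_pos
  -- On `[e/4, e/2]` the slope exceeds `L`, and by concavity the slope on `[0, e/4]` is at least as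
  -- large, against the supposed bound at `e/4`.
  obtain ⟨ξ, hξ, hmv⟩ := exists_deriv_eq_slope (fun c => (u c x).toReal)
    (by linarith : e / 4 < e / 2)
    ((hu.differentiableOn_c hx).continuousOn.mono fun t ht => mem_Ioi.2 (by linarith [ht.1]))
    ((hu.differentiableOn_c hx).mono fun t ht => mem_Ioi.2 (by linarith [ht.1]))
  have hξδ : L < utilityDerivC u ξ x :=
    hder ⟨by linarith [hξ.1], by linarith [hξ.2, min_le_left δ 1]⟩
  rw [utilityDerivC, hmv, lt_div_iff₀ (by linarith)] at hξδ
  have h1 := h (e / 4) (by linarith) (by linarith [min_le_right δ 1])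
  have h2 : ((u 0 x).toReal : EReal) = u 0 x := EReal.coe_toReal (hu.ne_top 0 x le_rfl hx.le) h0
  have h3 := hu.combo_le hx.le le_rfl hx.le (by linarith : (0 : ℝ) ≤ e / 2)
    (by norm_num : (0 : ℝ) < 1 / 2) (by norm_num : (0 : ℝ) < 1 / 2) (by norm_num) h2.le
    (hu.coe_toReal (by linarith : 0 < e / 2) hx).le
  have h4 : 1 / 2 * 0 + 1 / 2 * (e / 2) = e / 4 := by ring
  have h5 : 1 / 2 * x + 1 / 2 * x = x := by ring
  rw [h4, h5, ← hu.coe_toReal (by linarith : 0 < e / 4) hx, EReal.coe_le_coe_iff] at h3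
  linarith

/-- A consumption maximizing the Hamiltonian over positive consumptions is the policy value. -/
lemma isPolicyValue_of_le (hu : UtilityAssumption u) (hF : TechnologyAssumption W F)
    (hI : InadaAssumption u) (hx : 0 < x) {p c : ℝ} (hc : 0 ≤ c) (hbot : u c x ≠ ⊥)
    (hmax : ∀ c', 0 < c' → p * F x c' + (u c' x).toReal ≤ p * F x c + (u c x).toReal) :
    IsPolicyValue u F p x c := by
  have hcoe : ((u c x).toReal : EReal) = u c x := EReal.coe_toReal (hu.ne_top c x hc hx.le) hbot
  have hp : 0 < p := by
    have h1 := hmax (c + 1) (by linarith)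
    have h2 := hF.decreasing_c x c (c + 1) hx.le hc (by linarith)
    have h3 : (u c x).toReal < (u (c + 1) x).toReal := by
      rw [← EReal.coe_lt_coe_iff, hcoe, hu.coe_toReal (by linarith) hx]
      -- The detour through `c + 1/2` is needed since `c` may be `0`, where strict monotonicity is
      -- not assumed.
      exact (hu.monotone c (c + 1 / 2) x x hc (by linarith) hx.le le_rfl).trans_lt
        (hu.increasing_c _ _ x (by linarith) (by linarith) hx)
    by_contra hp
    nlinarith [mul_nonneg (neg_nonneg.2 (not_lt.1 hp)) (sub_nonneg.2 h2.le)]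
  have hc0 : 0 < c := by
    rcases hc.eq_or_lt with h | h
    · subst h
      -- Were `0` a maximizer, concavity of `F x` on `[0, 1]` would bound the gain in utility by `L
      -- c'`.
      refine absurd (fun c' hc' hc1 => ?_)
        (not_supported_at_zero hu hI hx hbot (L := p * (F x 0 - F x 1)))
      have h1 := hmax c' hc'
      have h2 := hF.combo_le (a := 1 - c') (b := c') hx.le le_rfl hx.le zero_le_one
        (by linarith) hc'.le (by ring)
      have h3 : (1 - c') * x + c' * x = x := by ring
      have h4 : (1 - c') * 0 + c' * 1 = c' := by ring
      rw [h3, h4] at h2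
      have h5 := mul_le_mul_of_nonneg_left h2 hp.le
      linarith
    · exact h
  have hstrict : ∀ c', 0 < c' → c' ≠ c →
      p * F x c' + (u c' x).toReal < p * F x c + (u c x).toReal := by
    intro c' hc' hne
    have h1 := (strictConcaveOn_utility hu hI hx).2 (mem_Ioi.2 hc') (mem_Ioi.2 hc0) hne
      (by norm_num : (0 : ℝ) < 1 / 2) (by norm_num : (0 : ℝ) < 1 / 2) (by norm_num)
    have h2 := hF.combo_le (a := 1 / 2) (b := 1 / 2) hx.le hc'.le hx.le hc (by norm_num)
      (by norm_num) (by norm_num)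
    have h3 : 1 / 2 * x + 1 / 2 * x = x := by ring
    simp only [smul_eq_mul] at h1
    rw [h3] at h2
    have h4 := hmax (1 / 2 * c' + 1 / 2 * c) (by positivity)
    have h5 := mul_le_mul_of_nonneg_left h2 hp.le
    linarith
  refine ⟨hp, hx, hc0, fun c' hc' hne => ?_⟩
  rw [← hcoe, ← EReal.coe_add]
  by_cases hb' : u c' x = ⊥
  · rw [hb', EReal.add_bot]
    exact EReal.bot_lt_coe _
  have hcoe' : ((u c' x).toReal : EReal) = u c' x :=
    EReal.coe_toReal (hu.ne_top c' x hc' hx.le) hb'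
  rw [← hcoe', ← EReal.coe_add, EReal.coe_lt_coe_iff]
  -- `c' = 0` is allowed here, so strictness is applied at the positive midpoint and carried to `c'`
  -- by concavity.
  have hm : 0 < 1 / 2 * c' + 1 / 2 * c := by positivity
  have h1 := hstrict (1 / 2 * c' + 1 / 2 * c) hm fun h => hne (by linarith)
  have h2 := hF.combo_le (a := 1 / 2) (b := 1 / 2) hx.le hc' hx.le hc (by norm_num)
    (by norm_num) (by norm_num)
  have h3 : 1 / 2 * x + 1 / 2 * x = x := by ring
  have h4 := hu.combo_le hx.le hc' hx.le hc (by norm_num : (0 : ℝ) < 1 / 2)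
    (by norm_num : (0 : ℝ) < 1 / 2) (by norm_num) hcoe'.le hcoe.le
  rw [h3] at h2
  rw [h3, ← hu.coe_toReal hm hx, EReal.coe_le_coe_iff] at h4
  have h5 := mul_le_mul_of_nonneg_left h2 hp.le
  linarith

/-! ### Optimal paths -/

/-- Along an optimal pair the value function is the current value of the remaining utility. -/
lemma realValue_eq_of_optimal (hρ : 0 < ρ) (hW : W = W₁ ∨ W = W₂) (hu : UtilityAssumption u)
    (hF : TechnologyAssumption W F) (hG : GrowthAssumption ρ u F) (hx : 0 < x)
    (hf : FeasibleOn (Ici 0) ρ W u F x k c v w)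
    (hJ : ∫ t in Ici (0 : ℝ), Real.exp (-ρ * t) * w t = realValue ρ W u F x)
    {t : ℝ} (ht : 0 ≤ t) (hkt : 0 < k t) :
    realValue ρ W u F (k t) = Real.exp (ρ * t) *
      (realValue ρ W u F x - ∫ s in (0 : ℝ)..t, Real.exp (-ρ * s) * w s) := by
  have h1 := (hf.mono Icc_subset_Ici_self).add_realValue_le hρ hW hu hF hG hx ht hkt
  have h2 := (valueFunction_eq hρ hW hu hF hG hkt).2.1 (hf.tail hW ht)
  rw [hJ] at h2
  refine le_antisymm ?_ h2
  rw [integral_Icc_eq_integral_Ioc, ← intervalIntegral.integral_of_le ht] at h1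
  have h3 : Real.exp (-ρ * t) * realValue ρ W u F (k t)
      ≤ realValue ρ W u F x - ∫ s in (0 : ℝ)..t, Real.exp (-ρ * s) * w s := by linarith
  have h4 := mul_le_mul_of_nonneg_left h3 (Real.exp_pos (ρ * t)).le
  rwa [← mul_assoc, ← Real.exp_add, neg_mul, add_neg_cancel, Real.exp_zero, one_mul] at h4

/-- Along an optimal pair, a price of capital makes the current consumption a policy value. -/
lemma ae_mem_policySet (hρ : 0 < ρ) (hW : W = W₁ ∨ W = W₂) (hu : UtilityAssumption u)
    (hF : TechnologyAssumption W F) (hI : InadaAssumption u) (hG : GrowthAssumption ρ u F)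
    (hopt : IsOptimal ρ W u F x k c) (hk : ∀ t, 0 ≤ t → 0 < k t) :
    ∀ᵐ t ∂(volume.restrict (Ici (0 : ℝ))),
      c t ∈ policySet u F (superdifferential (valueFunction ρ W u F) (k t)) (k t) := by
  have hadm := hopt.admissible
  have hx : 0 < x := by
    rw [← hadm.initial]
    exact hk 0 le_rfl
  have hneg : utilityNeg ρ u k c ≠ ⊤ := by
    intro h
    apply hopt.ne_bot
    rw [totalUtility, h, EReal.coe_ennreal_top, EReal.sub_top]
  obtain ⟨hne, hf, hJ⟩ :=
    hadm.feasibleOn hW hu hF (hadm.utilityPos_ne_top hρ hW hu hG) hneg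
  set w : ℝ → ℝ := fun t => (u (c t) (k t)).toReal with hw
  have hval : valueFunction ρ W u F x = totalUtility ρ u k c := by
    refine le_antisymm (sSup_le ?_) (le_sSup ⟨k, c, hadm, rfl⟩)
    rintro J ⟨k', c', h', rfl⟩
    exact hopt.maximal k' c' h'
  have hJ' : ∫ t in Ici (0 : ℝ), Real.exp (-ρ * t) * w t = realValue ρ W u F x := by
    rw [realValue, hval, hJ, EReal.toReal_coe]
  have hdpp := fun t (ht : 0 ≤ t) =>
    realValue_eq_of_optimal hρ hW hu hF hG hx hf hJ' ht (hk t ht)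
  have hΦ := ae_hasDerivAt_of_eq_integral (x := 0)
    (k := fun t => ∫ s in (0 : ℝ)..t, Real.exp (-ρ * s) * w s)
    (fun T _ => hf.integrable_w.mono_set Icc_subset_Ici_self) fun t _ => (zero_add _).symm
  have h0 : ∀ᵐ t ∂(volume.restrict (Ici (0 : ℝ))), t ≠ 0 := ae_restrict_of_ae (by simp [ae_iff])
  filter_upwards [hne, hΦ, h0, hadm.hasDerivAt, ae_restrict_mem measurableSet_Ici]
    with t hcoe hΦt ht0 hkd ht
  have htpos : 0 < t := lt_of_le_of_ne ht (Ne.symm ht0)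
  -- The price is chosen separately at each time; no measurability in `t` is required.
  obtain ⟨p, hsup, hham⟩ := exists_price hρ hW hu hF hG (hk t ht)
  -- Differentiability comes from the integral formula for `V(k(s))`, so it holds even where `V` has
  -- a kink.
  have hVd : HasDerivAt (fun s => realValue ρ W u F (k s))
      (ρ * realValue ρ W u F (k t) - w t) t := by
    have he : HasDerivAt (fun s : ℝ => Real.exp (ρ * s)) (Real.exp (ρ * t) * ρ) t := by
      simpa using ((hasDerivAt_id t).const_mul ρ).exp
    have h1 := he.mul (hΦt.const_sub (realValue ρ W u F x))
    have h2 : HasDerivAt (fun s => realValue ρ W u F (k s)) _ t :=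
      h1.congr_of_eventuallyEq (by
        filter_upwards [lt_mem_nhds htpos] with s hs
        exact hdpp s hs.le)
    refine h2.congr_deriv ?_
    rw [hdpp t ht]
    have h3 : Real.exp (ρ * t) * (Real.exp (-ρ * t) * w t) = w t := by
      rw [← mul_assoc, ← Real.exp_add, neg_mul, add_neg_cancel, Real.exp_zero, one_mul]
    linarith
  -- The supergradient line touches `V` at `k t`; stationarity gives `p F(k, c) = ρ V(k) - u(c, k)`,
  -- equality in the Hamiltonian inequality.
  have hmin : IsLocalMin (fun s => p * k s - realValue ρ W u F (k s)) t := by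
    filter_upwards [lt_mem_nhds htpos] with s hs
    linarith [hsup (k s) (hk s hs.le)]
  have hcrit := hmin.hasDerivAt_eq_zero ((hkd.const_mul p).sub hVd)
  have hbot : u (c t) (k t) ≠ ⊥ := by
    rw [hcoe]
    exact EReal.coe_ne_bot _
  refine ⟨p, ?_, isPolicyValue_of_le hu hF hI (hk t ht) (hadm.nonneg_c t ht) hbot
    fun c' hc' => ?_⟩
  · have hV := (valueFunction_eq hρ hW hu hF hG (hk t ht)).1
    refine ⟨by simp [hV], by simp [hV], fun y hy => ?_⟩
    rw [hV, (valueFunction_eq hρ hW hu hF hG hy).1, ← EReal.coe_add, EReal.coe_le_coe_iff]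
    exact hsup y hy
  · have := hham c' hc'
    simp only [hw] at hcrit
    linarith

end RCK

theorem proposition5 (ρ : ℝ) (hρ : 0 < ρ)
    (W : Set (ℝ → ℝ)) (hW : W = RCK.W₁ ∨ W = RCK.W₂)
    (u : ℝ → ℝ → EReal) (F : ℝ → ℝ → ℝ)
    (hu : RCK.UtilityAssumption u)
    (hF : RCK.TechnologyAssumption W F)
    (hInada : RCK.InadaAssumption u)
    (hGrowth : RCK.GrowthAssumption ρ u F)
    (kbar : ℝ) (k c : ℝ → ℝ)
    (hopt : RCK.IsOptimal ρ W u F kbar k c)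
    (hinf : 0 < sInf (k '' Set.Ici 0)) :
    RCK.IsInclusionSolution (RCK.inclusionMap u F (RCK.valueFunction ρ W u F)) kbar k ∧
    ∀ᵐ t ∂(MeasureTheory.volume.restrict (Set.Ici (0 : ℝ))),
      c t ∈ RCK.policySet u F (RCK.superdifferential (RCK.valueFunction ρ W u F) (k t)) (k t) := by
  have hadm := hopt.admissible
  have hk : ∀ t, 0 ≤ t → 0 < k t := fun t ht =>
    hinf.trans_le (csInf_le ⟨0, by rintro y ⟨s, hs, rfl⟩; exact hadm.nonneg_k s hs⟩
      (mem_image_of_mem k ht))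
  have hpol := RCK.ae_mem_policySet hρ hW hu hF hInada hGrowth hopt hk
  refine ⟨⟨hk, hadm.locallyAC, hadm.initial, ?_⟩, hpol⟩
  filter_upwards [hpol, hadm.hasDerivAt] with t h1 h2
  exact ⟨_, mem_image_of_mem _ h1, h2⟩
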